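/- **Theorem 4.4.** Let $n\ge 3$. For $\alpha_3,\dots,\alpha_n,\theta\in\mathbb C$ let $L(\alpha_3,\dots,\alpha_n,\theta)$ (family $\mu_1$) be the complex Leibniz algebra with basis $e_0,\dots,e_n$ and products (those not listed are zero) $$[e_0,e_0]=e_2,\quad [e_i,e_0]=e_{i+1}\ (1\le i\le n-1),\quad [e_0,e_1]=\sum_{k=3}^{n-1}\alpha_k e_k+\theta e_n,\quad [e_j,e_1]=\sum_{k=3}^{n+1-j}\alpha_k e_{j+k-1}\ (1\le j\le n-2).$$ For $\beta_3,\dots,\beta_n,\gamma\in\mathbb C$ let $L(\beta_3,\dots,\beta_n,\gamma)$ (family $\mu_2$) be the complex Leibniz algebra with basis $e_0,\dots,e_n$ and products (those not listed are zero) $$[e_0,e_0]=e_2,\quad [e_i,e_0]=e_{i+1}\ (2\le i\le n-1),\quad [e_0,e_1]=\sum_{k=3}^{n}\beta_k e_k,\quad [e_1,e_1]=\gamma e_n,\quad [e_j,e_1]=\sum_{k=3}^{n+1-j}\beta_k e_{j+k-1}\ (2\le j\le n-2).$$ For $\eta=(\eta_3,\dots,\eta_n)$, $A,B\in\mathbb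 C$ and $3\le k<t\le n$ put $$\Phi^{\eta}_{k,t}(A,B)=\sum_{m=1}^{k-1}\binom{k-1}{k-1-m}A^{k-1-m}B^m\,S^{\eta}_{m,k}(t),$$ where $S^{\eta}_{1,k}(t)=\eta_{t+2-k}$ and, for $m\ge 2$, $$S^{\eta}_{m,k}(t)=\sum_{i_{m-1}=k+m}^{t}\ \sum_{i_{m-2}=k+m}^{i_{m-1}}\cdots\sum_{i_1=k+m}^{i_2}\eta_{t+3-i_{m-1}}\,\eta_{i_{m-1}+3-i_{m-2}}\cdots\eta_{i_2+3-i_1}\,\eta_{i_1+3-(k+m)}$$ (an empty sum is $0$). (a) The algebras $L(\alpha_3,\dots,\alpha_n,\theta)$ and $L'(\alpha'_3,\dots,\alpha'_n,\theta')$ of the family $\mu_1$ are isomorphic if and only if there are $A,B\in\mathbb C$ with $A(A+B)\ne 0$ such that $$\alpha'_3=\frac{A+B}{A^2}\,\alpha_3,\qquad \alpha'_t=\frac1{A^{t-1}}\Big((A+B)\alpha_t-\sum_{k=3}^{t-1}\Phi^{\alpha}_{k,t}(A,B)\,\alpha'_k\Big)\quad(4\le t\le n),$$ $$\theta'=\frac1{A^{n-1}}\Big(A\theta+B\alpha_n-\sum_{k=3}^{n-1}\Phi^{\alpha}_{k,n}(A,B)\,\alpha'_k\Big).$$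 (b) The algebras $L(\beta_3,\dots,\beta_n,\gamma)$ and $L'(\beta'_3,\dots,\beta'_n,\gamma')$ of the family $\mu_2$ are isomorphic if and only if there are $A,B,D\in\mathbb C$ with $AD\ne0$ such that $$\gamma'=\frac{D^2}{A^n}\,\gamma,\qquad \beta'_3=\frac{D}{A^2}\,\beta_3\ \text{ if } n\ge 4,\qquad \beta'_t=\frac1{A^{t-1}}\Big(D\beta_t-\sum_{k=3}^{t-1}\Phi^{\beta}_{k,t}(A,B)\,\beta'_k\Big)\quad(4\le t\le n-1),$$ $$\beta'_n=\frac{BD\gamma}{A^n}+\frac1{A^{n-1}}\Big(D\beta_n-\sum_{k=3}^{n-1}\Phi^{\beta}_{k,n}(A,B)\,\beta'_k\Big).$$ -/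

import Mathlib

open Finset

/-- A (right) Leibniz algebra structure on a vector space `V`: a bilinear bracket with
`[x, [y, z]] = [[x, y], z] - [[x, z], y]`. -/
structure LeibnizAlgebra (K V : Type*) [Field K] [AddCommGroup V] [Module K V] where
  bracket : V →ₗ[K] V →ₗ[K] V
  leibniz : ∀ x y z : V,
    bracket x (bracket y z) = bracket (bracket x y) z - bracket (bracket x z) y

/-- Two Leibniz algebras are isomorphic if there is a linear bijection between them that
respects the brackets. -/
def LeibnizAlgebra.Isomorphic {K V W : Type*} [Field K] [AddCommGroup V] [Module K V]
    [AddCommGroup W] [Module K W] (L : LeibnizAlgebra K V) (M : LeibnizAlgebra K W) : Prop :=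
  ∃ φ : V ≃ₗ[K] W, ∀ x y : V, φ (L.bracket x y) = M.bracket (φ x) (φ y)

noncomputable section

namespace FiliformLeibniz

/-- The basis vector `e_i` of `ℂ^(n+1)`, `0 ≤ i ≤ n` (and `0` for `i > n`). -/
def e (n i : ℕ) : Fin (n + 1) → ℂ :=
  if h : i < n + 1 then Pi.single ⟨i, h⟩ 1 else 0

/-- The bilinear map on `ℂ^(n+1)` with `[e_i, e_j] = T i j` for `0 ≤ i, j ≤ n`. -/
def bracketOfTable (n : ℕ) (T : ℕ → ℕ → Fin (n + 1) → ℂ) :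
    (Fin (n + 1) → ℂ) →ₗ[ℂ] (Fin (n + 1) → ℂ) →ₗ[ℂ] (Fin (n + 1) → ℂ) :=
  (Pi.basisFun ℂ (Fin (n + 1))).constr ℂ fun i =>
    (Pi.basisFun ℂ (Fin (n + 1))).constr ℂ fun j => T i j

/-- The multiplication table `[e_i, e_j]` of the first family; products not listed are zero. -/
def table₁ (n : ℕ) (α : ℕ → ℂ) (θ : ℂ) (i j : ℕ) : Fin (n + 1) → ℂ :=
  if i = 0 ∧ j = 0 then e n 2
  else if (1 ≤ i ∧ i ≤ n - 1) ∧ j = 0 then e n (i + 1)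
  else if i = 0 ∧ j = 1 then (∑ k ∈ Icc 3 (n - 1), α k • e n k) + θ • e n n
  else if (1 ≤ i ∧ i ≤ n - 2) ∧ j = 1 then ∑ k ∈ Icc 3 (n + 1 - i), α k • e n (i + k - 1)
  else 0

/-- The multiplication table `[e_i, e_j]` of the second family; products not listed are zero. -/
def table₂ (n : ℕ) (β : ℕ → ℂ) (γ : ℂ) (i j : ℕ) : Fin (n + 1) → ℂ :=
  if i = 0 ∧ j = 0 then e n 2
  else if (2 ≤ i ∧ i ≤ n - 1) ∧ j = 0 then e n (i + 1)
  else if i = 0 ∧ j = 1 then ∑ k ∈ Icc 3 n, β k • e n k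
  else if i = 1 ∧ j = 1 then γ • e n n
  else if (2 ≤ i ∧ i ≤ n - 2) ∧ j = 1 then ∑ k ∈ Icc 3 (n + 1 - i), β k • e n (i + k - 1)
  else 0

theorem e_of_gt {n i : ℕ} (h : n < i) : e n i = 0 := by
  rw [e, dif_neg (by omega)]

theorem e_apply_of_ne {n i : ℕ} (j : Fin (n + 1)) (h : i ≠ j) : e n i j = 0 := by
  unfold e
  split_ifs with h'
  · rw [Pi.single_eq_of_ne]
    intro hj
    exact h (by rw [hj])
  · rfl

theorem bracketOfTable_e {n : ℕ} (T : ℕ → ℕ → Fin (n + 1) → ℂ) {i j : ℕ} (hi : i ≤ n)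
    (hj : j ≤ n) : bracketOfTable n T (e n i) (e n j) = T i j := by
  have h (k : ℕ) (hk : k ≤ n) : e n k = Pi.basisFun ℂ (Fin (n + 1)) ⟨k, by omega⟩ := by
    rw [e, dif_pos (by omega), Pi.basisFun_apply]
  rw [h i hi, h j hj, bracketOfTable, Module.Basis.constr_basis, Module.Basis.constr_basis]

/-- A table in which only `e_0` and `e_1` multiply nontrivially from the right, all products lie
in the span of `e_2, …, e_n`, and right multiplications by `e_0` and `e_1` commute, satisfies the
Leibniz identity. -/
theorem leibniz_of_table {n : ℕ} (hn : 1 ≤ n) (T : ℕ → ℕ → Fin (n + 1) → ℂ)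
    (h0 : ∀ i j, 2 ≤ j → T i j = 0)
    (h1 : ∀ i j, ∀ k : Fin (n + 1), (k : ℕ) < 2 → T i j k = 0)
    (h2 : ∀ i, i ≤ n → bracketOfTable n T (T i 0) (e n 1) = bracketOfTable n T (T i 1) (e n 0))
    (x y z : Fin (n + 1) → ℂ) :
    bracketOfTable n T x (bracketOfTable n T y z) =
      bracketOfTable n T (bracketOfTable n T x y) z -
        bracketOfTable n T (bracketOfTable n T x z) y := by
  set b := bracketOfTable n T with hb
  have hbas (k : Fin (n + 1)) : Pi.basisFun ℂ (Fin (n + 1)) k = e n k := by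
    rw [e, dif_pos k.2, Pi.basisFun_apply]
  have he (i j : Fin (n + 1)) : b (e n i) (e n j) = T i j :=
    bracketOfTable_e T (by omega) (by omega)
  have key (x y : Fin (n + 1) → ℂ) :
      b x y = y ⟨0, by omega⟩ • b x (e n 0) + y ⟨1, by omega⟩ • b x (e n 1) := by
    have hx : b = (LinearMap.lsmul ℂ _ ∘ₗ LinearMap.proj (R := ℂ) (φ := fun _ : Fin (n + 1) => ℂ)
        ⟨0, by omega⟩).flip.comp (b.flip (e n 0)) +
        (LinearMap.lsmul ℂ _ ∘ₗ LinearMap.proj (R := ℂ) (φ := fun _ : Fin (n + 1) => ℂ)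
        ⟨1, by omega⟩).flip.comp (b.flip (e n 1)) := by
      refine (Pi.basisFun ℂ (Fin (n + 1))).ext fun i => (Pi.basisFun ℂ (Fin (n + 1))).ext fun j => ?_
      rw [hbas, hbas]
      simp only [LinearMap.add_apply, LinearMap.comp_apply, LinearMap.flip_apply,
        LinearMap.lsmul_apply, LinearMap.proj_apply]
      have e0 := he i ⟨0, by omega⟩
      have e1 := he i ⟨1, by omega⟩
      simp only at e0 e1
      rw [e0, e1, he]
      rcases j with ⟨_ | _ | j, hj⟩
      · simp [e]
      · have hn' : 0 < n := by omega
        simp [e, hn']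
      · rw [h0 _ _ (by simp), e_apply_of_ne _ (by simp), e_apply_of_ne _ (by simp)]
        simp
    conv_lhs => rw [hx]
    rfl
  have zero (y z : Fin (n + 1) → ℂ) (k : Fin (n + 1)) (hk : (k : ℕ) < 2) : b y z k = 0 := by
    have : b.compr₂ (LinearMap.proj (R := ℂ) (φ := fun _ : Fin (n + 1) => ℂ) k) = 0 := by
      refine (Pi.basisFun ℂ (Fin (n + 1))).ext fun i => (Pi.basisFun ℂ (Fin (n + 1))).ext fun j => ?_
      rw [hbas, hbas]
      simp only [LinearMap.compr₂_apply, he, LinearMap.proj_apply, LinearMap.zero_apply]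
      exact h1 _ _ _ hk
    have h := LinearMap.congr_fun₂ this y z
    simpa using h
  have comm (x : Fin (n + 1) → ℂ) : b (b x (e n 0)) (e n 1) = b (b x (e n 1)) (e n 0) := by
    have : b.flip (e n 1) ∘ₗ b.flip (e n 0) = b.flip (e n 0) ∘ₗ b.flip (e n 1) := by
      refine (Pi.basisFun ℂ (Fin (n + 1))).ext fun i => ?_
      rw [hbas]
      simp only [LinearMap.comp_apply, LinearMap.flip_apply]
      have e0 := he i ⟨0, by omega⟩
      have e1 := he i ⟨1, by omega⟩
      simp only at e0 e1
      rw [e0, e1, h2 _ (by omega)]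
    exact LinearMap.congr_fun this x
  rw [key x (b y z), zero y z _ (by simp), zero y z _ (by simp), key x y, key x z]
  rw [key _ z, key _ y]
  simp only [map_add, map_smul, LinearMap.add_apply, LinearMap.smul_apply, comm]
  module

theorem table₁_zero {n : ℕ} (α : ℕ → ℂ) (θ : ℂ) {i : ℕ} (hi : 1 ≤ i) :
    table₁ n α θ i 0 = e n (i + 1) := by
  unfold table₁
  rw [if_neg (by omega)]
  split_ifs with h
  · rfl
  all_goals first | omega | exact (e_of_gt (by omega)).symm

theorem table₁_one {n : ℕ} (α : ℕ → ℂ) (θ : ℂ) {i : ℕ} (hi : 1 ≤ i) :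
    table₁ n α θ i 1 = ∑ k ∈ Icc 3 (n + 1 - i), α k • e n (i + k - 1) := by
  unfold table₁
  rw [if_neg (by omega), if_neg (by omega), if_neg (by omega)]
  split_ifs with h
  · rfl
  · rw [Icc_eq_empty (by omega), sum_empty]

theorem table₂_zero {n : ℕ} (β : ℕ → ℂ) (γ : ℂ) {i : ℕ} (hi : 2 ≤ i) :
    table₂ n β γ i 0 = e n (i + 1) := by
  unfold table₂
  rw [if_neg (by omega)]
  split_ifs with h
  · rfl
  all_goals first | omega | exact (e_of_gt (by omega)).symm

theorem table₂_one {n : ℕ} (β : ℕ → ℂ) (γ : ℂ) {i : ℕ} (hi : 2 ≤ i) :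
    table₂ n β γ i 1 = ∑ k ∈ Icc 3 (n + 1 - i), β k • e n (i + k - 1) := by
  unfold table₂
  rw [if_neg (by omega), if_neg (by omega), if_neg (by omega), if_neg (by omega)]
  split_ifs with h
  · rfl
  · rw [Icc_eq_empty (by omega), sum_empty]

/-- Multiplying `∑ α_k e_{i+k-1}` by `e_0` from the right shifts it. -/
theorem shift_sum {n : ℕ} (T : ℕ → ℕ → Fin (n + 1) → ℂ)
    (hT : ∀ j, 2 ≤ j → j ≤ n → T j 0 = e n (j + 1)) (α : ℕ → ℂ) {i : ℕ} (hi : 1 ≤ i)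
    (hin : i ≤ n) :
    bracketOfTable n T (∑ k ∈ Icc 3 (n + 1 - i), α k • e n (i + k - 1)) (e n 0) =
      ∑ k ∈ Icc 3 (n - i), α k • e n (i + k) := by
  rw [map_sum, LinearMap.sum_apply]
  have h (k : ℕ) (hk : k ∈ Icc 3 (n + 1 - i)) :
      bracketOfTable n T (α k • e n (i + k - 1)) (e n 0) = α k • e n (i + k) := by
    rw [mem_Icc] at hk
    rw [map_smul, LinearMap.smul_apply, bracketOfTable_e T (by omega) (by omega),
      hT _ (by omega) (by omega)]
    congr 2
    omega
  rw [sum_congr rfl h]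
  symm
  apply sum_subset
  · intro k
    simp only [mem_Icc]
    omega
  · intro k hk hk'
    simp only [mem_Icc] at hk hk'
    rw [e_of_gt (by omega), smul_zero]

/-- The algebra `L(α_3, …, α_n, θ)` of the first family, on `ℂ^(n+1)`. Only the values
`α 3, …, α n` of the sequence `α` matter. -/
def mu₁ (n : ℕ) (hn : 3 ≤ n) (α : ℕ → ℂ) (θ : ℂ) : LeibnizAlgebra ℂ (Fin (n + 1) → ℂ) where
  bracket := bracketOfTable n (table₁ n α θ)
  leibniz := by
    apply leibniz_of_table (by omega)
    · intro i j hj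
      unfold table₁
      rw [if_neg (by omega), if_neg (by omega), if_neg (by omega), if_neg (by omega)]
    · intro i j k hk
      unfold table₁
      split_ifs with h h h h
      · exact e_apply_of_ne _ (by omega)
      · exact e_apply_of_ne _ (by omega)
      · rw [Pi.add_apply, Finset.sum_apply, sum_eq_zero, Pi.smul_apply, e_apply_of_ne _ (by omega)]
        · simp
        · intro l hl
          rw [mem_Icc] at hl
          rw [Pi.smul_apply, e_apply_of_ne _ (by omega), smul_zero]
      · rw [Finset.sum_apply, sum_eq_zero]
        intro l hl
        rw [mem_Icc] at hl
        rw [Pi.smul_apply, e_apply_of_ne _ (by omega), smul_zero]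
      · rfl
    · have hT : ∀ j, 2 ≤ j → j ≤ n → table₁ n α θ j 0 = e n (j + 1) := fun j h1 _ =>
        table₁_zero α θ (by omega)
      intro i hi
      have h2 : bracketOfTable n (table₁ n α θ) (e n 2) (e n 1) =
          ∑ k ∈ Icc 3 (n - 1), α k • e n (1 + k) := by
        rw [bracketOfTable_e _ (by omega) (by omega), table₁_one α θ (by omega)]
        refine sum_congr (by congr 1) fun k hk => ?_
        congr 2
        omega
      rcases Nat.eq_zero_or_pos i with rfl | h
      · have e0 : table₁ n α θ 0 0 = e n 2 := by simp [table₁]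
        have e1 : table₁ n α θ 0 1 = (∑ k ∈ Icc 3 (n + 1 - 1), α k • e n (1 + k - 1)) +
            (θ - α n) • e n n := by
          have : table₁ n α θ 0 1 = (∑ k ∈ Icc 3 (n - 1), α k • e n k) + θ • e n n := by
            simp [table₁]
          obtain ⟨m, rfl⟩ : ∃ m, n = m + 1 := ⟨n - 1, by omega⟩
          rw [this, Nat.add_sub_cancel, Nat.add_sub_cancel, sum_Icc_succ_top (by omega)]
          simp only [Nat.add_sub_cancel_left]
          module
        rw [e0, e1, map_add, LinearMap.add_apply, shift_sum _ hT α (by omega) (by omega), map_smul,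
          LinearMap.smul_apply, bracketOfTable_e _ le_rfl (Nat.zero_le n), hT n (by omega) le_rfl,
          e_of_gt (Nat.lt_succ_self n), smul_zero, add_zero, h2]
      · rw [table₁_zero α θ h, table₁_one α θ h, shift_sum _ hT α h hi]
        rcases Nat.lt_or_ge i n with h' | h'
        · rw [bracketOfTable_e _ (by omega) (by omega), table₁_one α θ (by omega)]
          refine sum_congr (by congr 1; omega) fun k hk => ?_
          congr 2
          omega
        · rw [e_of_gt (by omega), Icc_eq_empty (by omega)]
          simp

/-- The algebra `L(β_3, …, β_n, γ)` of the second family, on `ℂ^(n+1)`. Only the values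
`β 3, …, β n` of the sequence `β` matter. -/
def mu₂ (n : ℕ) (hn : 3 ≤ n) (β : ℕ → ℂ) (γ : ℂ) : LeibnizAlgebra ℂ (Fin (n + 1) → ℂ) where
  bracket := bracketOfTable n (table₂ n β γ)
  leibniz := by
    apply leibniz_of_table (by omega)
    · intro i j hj
      unfold table₂
      rw [if_neg (by omega), if_neg (by omega), if_neg (by omega), if_neg (by omega),
        if_neg (by omega)]
    · intro i j k hk
      unfold table₂
      split_ifs with h h h h h
      · exact e_apply_of_ne _ (by omega)
      · exact e_apply_of_ne _ (by omega)
      · rw [Finset.sum_apply, sum_eq_zero]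
        intro l hl
        rw [mem_Icc] at hl
        rw [Pi.smul_apply, e_apply_of_ne _ (by omega), smul_zero]
      · rw [Pi.smul_apply, e_apply_of_ne _ (by omega), smul_zero]
      · rw [Finset.sum_apply, sum_eq_zero]
        intro l hl
        rw [mem_Icc] at hl
        rw [Pi.smul_apply, e_apply_of_ne _ (by omega), smul_zero]
      · rfl
    · have hT : ∀ j, 2 ≤ j → j ≤ n → table₂ n β γ j 0 = e n (j + 1) := fun j h1 _ =>
        table₂_zero β γ h1
      intro i hi
      rcases Nat.lt_or_ge i 2 with h | h
      · obtain rfl | rfl : i = 0 ∨ i = 1 := by omega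
        · have e0 : table₂ n β γ 0 0 = e n 2 := by simp [table₂]
          have e1 : table₂ n β γ 0 1 = ∑ k ∈ Icc 3 (n + 1 - 1), β k • e n (1 + k - 1) := by
            simp [table₂]
          rw [e0, e1, shift_sum _ hT β (by omega) (by omega),
            bracketOfTable_e _ (by omega) (by omega), table₂_one β γ (by omega)]
          refine sum_congr (by congr 1) fun k hk => ?_
          congr 2
          omega
        · have e0 : table₂ n β γ 1 0 = 0 := by simp [table₂]
          have e1 : table₂ n β γ 1 1 = γ • e n n := by simp [table₂]
          rw [e0, e1, map_smul, LinearMap.smul_apply, bracketOfTable_e _ le_rfl (Nat.zero_le n),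
            hT n (by omega) le_rfl, e_of_gt (Nat.lt_succ_self n)]
          simp
      · rw [table₂_zero β γ h, table₂_one β γ h, shift_sum _ hT β (by omega) hi]
        rcases Nat.lt_or_ge i n with h' | h'
        · rw [bracketOfTable_e _ (by omega) (by omega), table₂_one β γ (by omega)]
          refine sum_congr (by congr 1; omega) fun k hk => ?_
          congr 2
          omega
        · rw [e_of_gt (by omega), Icc_eq_empty (by omega)]
          simp

/-- The nested sum with `r` summation signs
`∑_{i_r=s}^{t} ∑_{i_{r-1}=s}^{i_r} ⋯ ∑_{i_1=s}^{i_2}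
  η_{t+3-i_r} η_{i_r+3-i_{r-1}} ⋯ η_{i_2+3-i_1} η_{i_1+3-s}`;
for `r = 0` it is `η_{t+3-s}`. -/
def nestedSum (η : ℕ → ℂ) (s : ℕ) : ℕ → ℕ → ℂ
  | 0, t => η (t + 3 - s)
  | r + 1, t => ∑ i ∈ Icc s t, η (t + 3 - i) * nestedSum η s r i

/-- The coefficient
`C_{k-1}^{k-2} A^{k-2} B η_{t+2-k} + C_{k-1}^{k-3} A^{k-3} B² ∑_{i_1=k+2}^{t} η_{t+3-i_1} η_{i_1+1-k}
  + ⋯ + B^{k-1} ∑_{i_{k-2}=2k-1}^{t} ⋯ ∑_{i_1=2k-1}^{i_2} η_{t+3-i_{k-2}} ⋯ η_{i_1+4-2k}`,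
whose summand with `B^m`, `1 ≤ m ≤ k - 1`, has `m - 1` summation signs, with all lower limits
equal to `k + m`. -/
def coeff (η : ℕ → ℂ) (A B : ℂ) (k t : ℕ) : ℂ :=
  ∑ m ∈ Icc 1 (k - 1),
    ((k - 1).choose (k - 1 - m) : ℂ) * A ^ (k - 1 - m) * B ^ m * nestedSum η (k + m) (m - 1) t

end FiliformLeibniz

end

/-! ### Homomorphisms between Leibniz algebras modelled on a truncated polynomial ring. -/

section TruncatedPolynomialModel

open Polynomial

/-! Both families live on ℂ[x]/(x^n) ⊕ ℂz. Let o be the class of 1; put o = e_1, z = e_0 - e_1 in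
the first family, o = e_0, z = e_1 in the second, and e_{k+1} = x^k o for 1 ≤ k < n. Right
multiplication by e_0 is multiplication by x and kills z; right multiplication by e_1 is
multiplication by f = ∑ α_k x^(k-1) (with β_k for α_k in the second family) and sends z to c
x^(n-1), where c is θ - α_n or γ; the other e_j act by zero.

Let φ be an isomorphism from the primed algebra to the unprimed one. Let A, B be the e_0- and
e_1-coordinates of φ(e_0), D the e_1-coordinate of φ(e_1), φ(o) = u + bz and φ(z) = w + az.
Multiplication by x is carried to multiplication by p = Ax + Bf, so φ(q) = q(p)u whenever x^2
divides q (`image_X_sq_mul`). Applied to [o, e_1] = f', after cancelling the unit u, this gives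
f'(p) ≡ Df + (Dbc/u(0)) x^(n-1) mod x^n; [z, e_1] gives c' A^(n-1) u(0) = Dac (`of_hom`).
Conversely, these relations and compatibility of the coordinates suffice (`exists_equiv`). Comparing
coordinates gives b = 0, a = A, u(0) = D = A + B in the first family and u(0) = A, b = B, a = D in
the second.

By the binomial theorem Φ_{k,t} is the coefficient of x^(t-1) in p^(k-1), so the congruence, read
coefficientwise, is the stated recursion (`X_pow_dvd_comp_sub_iff`). -/

/-- A presentation of a Leibniz algebra as `ℂ[X]/(X^n) × ℂ` in which right multiplication by `v`
is `ε₀ v` times multiplication by `X` plus `ε₁ v` times multiplication by `f`, perturbed by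
`(0, 1) ↦ (c X^(n-1), 0)`. -/
structure LeibnizAlgebra.TruncatedModel {V : Type*} [AddCommGroup V] [Module ℂ V]
    (L : LeibnizAlgebra ℂ V) (n : ℕ) (f : ℂ[X]) (c : ℂ) (ι : ℂ[X] × ℂ →ₗ[ℂ] V)
    (ε₀ ε₁ : V →ₗ[ℂ] ℂ) : Prop where
  surjective : Function.Surjective ι
  eq_zero_iff : ∀ q s, ι (q, s) = 0 ↔ X ^ n ∣ q ∧ s = 0
  X_sq_dvd : X ^ 2 ∣ f
  bracket_eq : ∀ q s v, L.bracket (ι (q, s)) v =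
    ε₀ v • ι (X * q, 0) + ε₁ v • ι (f * q + C (s * c) * X ^ (n - 1), 0)

namespace LeibnizAlgebra.TruncatedModel

variable {V : Type*} [AddCommGroup V] [Module ℂ V] {L L' : LeibnizAlgebra ℂ V} {n : ℕ}
  {f f' : ℂ[X]} {c c' : ℂ} {ι : ℂ[X] × ℂ →ₗ[ℂ] V} {ε₀ ε₁ : V →ₗ[ℂ] ℂ}

theorem eq_iff (h : L.TruncatedModel n f c ι ε₀ ε₁) (q r : ℂ[X]) (s t : ℂ) :
    ι (q, s) = ι (r, t) ↔ X ^ n ∣ q - r ∧ s = t := by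
  rw [← sub_eq_zero, ← map_sub, Prod.mk_sub_mk, h.eq_zero_iff, sub_eq_zero]

theorem bracket_eq' (h : L.TruncatedModel n f c ι ε₀ ε₁) (q : ℂ[X]) (s : ℂ) (v : V) :
    L.bracket (ι (q, s)) v =
      ι ((C (ε₀ v) * X + C (ε₁ v) * f) * q + C (ε₁ v * (s * c)) * X ^ (n - 1), 0) := by
  rw [h.bracket_eq, ← map_smul, ← map_smul, ← map_add]
  congr 1
  ext1
  · simp only [Prod.smul_mk, Prod.mk_add_mk, smul_eq_C_mul, C_mul]
    ring
  · simp

/-- The summand bz of the image of 1 adds a multiple of X^(n-1) to the image of X. One more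
multiplication by p, which X divides, pushes this error past X^n; hence the factor X^2. -/
theorem image_X_sq_mul (hn : 3 ≤ n) (h : L.TruncatedModel n f c ι ε₀ ε₁)
    (h' : L'.TruncatedModel n f' c' ι ε₀ ε₁) (φ : V →ₗ[ℂ] V)
    (hφ : ∀ x y, φ (L'.bracket x y) = L.bracket (φ x) (φ y)) {v₀ : V} (h₀ : ε₀ v₀ = 1)
    (h₁ : ε₁ v₀ = 0) {u : ℂ[X]} {b : ℂ} (hu : φ (ι (1, 0)) = ι (u, b)) (q : ℂ[X]) :
    φ (ι (X ^ 2 * q, 0)) =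
      ι ((X ^ 2 * q).comp (C (ε₀ (φ v₀)) * X + C (ε₁ (φ v₀)) * f) * u, 0) := by
  set p := C (ε₀ (φ v₀)) * X + C (ε₁ (φ v₀)) * f with hp
  have hXp : X ∣ p := by
    obtain ⟨g, rfl⟩ := h.X_sq_dvd
    exact ⟨C (ε₀ (φ v₀)) + C (ε₁ (φ v₀)) * (X * g), by rw [hp]; ring⟩
  have step (r r' : ℂ[X]) (s : ℂ) (hr : φ (ι (r, 0)) = ι (r', s)) : φ (ι (X * r, 0)) =
      ι (p * r' + C (ε₁ (φ v₀) * (s * c)) * X ^ (n - 1), 0) := by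
    have := hφ (ι (r, 0)) v₀
    rwa [hr, h.bracket_eq', h'.bracket_eq', h₀, h₁, ← hp, C_1, C_0, one_mul, zero_mul, zero_mul,
      C_0, zero_mul, add_zero, add_zero] at this
  have two : φ (ι (X * (X * 1), 0)) = ι (p * (p * u), 0) := by
    rw [step _ _ _ (step _ _ _ hu), h.eq_iff]
    refine ⟨?_, rfl⟩
    obtain ⟨p', hp'⟩ := hXp
    refine ⟨p' * C (ε₁ (φ v₀) * (b * c)), ?_⟩
    obtain ⟨m, rfl⟩ : ∃ m, n = m + 1 := ⟨n - 1, by omega⟩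
    rw [hp', zero_mul, mul_zero, C_0, Nat.add_sub_cancel]
    ring
  have pow (k : ℕ) : φ (ι (X ^ 2 * X ^ k, 0)) = ι (p ^ 2 * p ^ k * u, 0) := by
    induction k with
    | zero => rwa [show X ^ 2 * X ^ 0 = X * (X * (1 : ℂ[X])) by ring,
        show p ^ 2 * p ^ 0 * u = p * (p * u) by ring]
    | succ k ih =>
      have := step _ _ _ ih
      rw [zero_mul, mul_zero, C_0, zero_mul, add_zero] at this
      rwa [show X ^ 2 * X ^ (k + 1) = X * (X ^ 2 * X ^ k : ℂ[X]) by ring,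
        show p ^ 2 * p ^ (k + 1) * u = p * (p ^ 2 * p ^ k * u) by ring]
  induction q using Polynomial.induction_on' with
  | add q r hq hr =>
    have e1 : ((X ^ 2 * (q + r) : ℂ[X]), (0 : ℂ)) = (X ^ 2 * q, 0) + (X ^ 2 * r, 0) := by
      simp [mul_add]
    rw [e1, map_add, map_add, hq, hr, ← map_add]
    congr 1
    simp [mul_add, add_mul]
  | monomial k a =>
    have e1 : ((X ^ 2 * monomial k a : ℂ[X]), (0 : ℂ)) = a • (X ^ 2 * X ^ k, 0) := by
      rw [Prod.smul_mk, ← C_mul_X_pow_eq_monomial, smul_eq_C_mul, smul_zero]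
      congr 1
      ring
    rw [e1, map_smul, map_smul, pow, ← map_smul]
    congr 1
    rw [Prod.smul_mk, ← C_mul_X_pow_eq_monomial, smul_eq_C_mul, smul_zero]
    simp only [mul_comp, X_pow_comp, C_comp]
    congr 1
    ring

theorem _root_.Polynomial.isCoprime_X_of_coeff_zero_ne {u : ℂ[X]} (hu : u.coeff 0 ≠ 0) :
    IsCoprime X u := by
  rw [Irreducible.coprime_iff_not_dvd irreducible_X, X_dvd_iff]
  exact hu

theorem _root_.Polynomial.X_pow_succ_dvd_mul_X_pow_sub (u : ℂ[X]) (k : ℕ) :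
    X ^ (k + 1) ∣ u * X ^ k - C (u.coeff 0) * X ^ k := by
  obtain ⟨r, hr⟩ := X_dvd_iff.2 (show (u - C (u.coeff 0)).coeff 0 = 0 by simp)
  exact ⟨r, by rw [← sub_mul, hr]; ring⟩

/-- What a homomorphism forces on the structure constants. -/
theorem of_hom (hn : 3 ≤ n) (h : L.TruncatedModel n f c ι ε₀ ε₁)
    (h' : L'.TruncatedModel n f' c' ι ε₀ ε₁) (φ : V →ₗ[ℂ] V) (hinj : Function.Injective φ)
    (hφ : ∀ x y, φ (L'.bracket x y) = L.bracket (φ x) (φ y)) {v₀ v₁ : V} (h₀ : ε₀ v₀ = 1)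
    (h₁ : ε₁ v₀ = 0) (h₀' : ε₀ v₁ = 0) (h₁' : ε₁ v₁ = 1) {A B D : ℂ} (hA : ε₀ (φ v₀) = A)
    (hB : ε₁ (φ v₀) = B) (hD : ε₁ (φ v₁) = D) {u w : ℂ[X]} {a b : ℂ}
    (hu : φ (ι (1, 0)) = ι (u, b)) (hw : φ (ι (0, 1)) = ι (w, a)) :
    A ≠ 0 ∧ u.coeff 0 ≠ 0 ∧ a ≠ 0 ∧ ε₀ (φ v₁) = 0 ∧ w.coeff 0 = 0 ∧
      X ^ n ∣ f'.comp (C A * X + C B * f) - (C D * f + C (D * b * c / u.coeff 0) * X ^ (n - 1)) ∧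
      c' * (A ^ (n - 1) * u.coeff 0) = D * a * c := by
  obtain ⟨m, rfl⟩ : ∃ m, n = m + 3 := ⟨n - 3, by omega⟩
  have key := image_X_sq_mul hn h h' φ hφ h₀ h₁ hu
  rw [hA, hB] at key
  have e : m + 3 - 1 = m + 2 := by omega
  obtain ⟨g, hg⟩ := h.X_sq_dvd
  obtain ⟨g', hg'⟩ := h'.X_sq_dvd
  set p := C A * X + C B * f with hp
  obtain ⟨p', hp', hp0⟩ : ∃ p', p = X * p' ∧ p'.coeff 0 = A :=
    ⟨C A + C B * (X * g), by rw [hp, hg]; ring, by simp⟩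
  -- φ(X^(n-1)) = p^(n-1) u is nonzero by injectivity, whereas A = 0 or u(0) = 0 would make it
  -- divisible by X^n.
  have top := key (X ^ m)
  rw [← pow_add, add_comm 2 m, X_pow_comp] at top
  have htop : ¬ X ^ (m + 3) ∣ p ^ (m + 2) * u := by
    intro hd
    rw [(h.eq_zero_iff _ _).2 ⟨hd, rfl⟩, map_eq_zero_iff _ hinj, h.eq_zero_iff,
      X_pow_dvd_iff] at top
    simpa using top.1 (m + 2) (by omega)
  have hA0 : A ≠ 0 := by
    rintro rfl
    obtain ⟨p'', rfl⟩ := X_dvd_iff.2 hp0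
    apply htop
    exact ⟨X ^ (m + 1) * p'' ^ (m + 2) * u, by rw [hp']; ring⟩
  have hu0 : u.coeff 0 ≠ 0 := by
    intro h0
    obtain ⟨u', rfl⟩ := X_dvd_iff.2 h0
    apply htop
    exact ⟨p' ^ (m + 2) * u', by rw [hp']; ring⟩
  -- the relation `[o, v₁] = f'`
  have r1 := hφ (ι (1, 0)) v₁
  rw [hu, h.bracket_eq', h'.bracket_eq', h₀', h₁', hD, e] at r1
  simp only [C_0, C_1, zero_mul, mul_zero, zero_add, one_mul, add_zero, mul_one] at r1
  have r1' := key g'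
  rw [← hg'] at r1'
  rw [r1', h.eq_iff] at r1
  replace r1 := r1.1
  have hC0 : ε₀ (φ v₁) = 0 := by
    -- All other terms are divisible by X^2, so the coefficient of X isolates ε₀(φ v₁) u(0).
    rw [X_pow_dvd_iff] at r1
    have h2 : X ^ 2 ∣ f'.comp p * u - (C D * f * u + C (D * (b * c)) * X ^ (m + 2)) := by
      refine dvd_sub (Dvd.dvd.mul_right ?_ _) (dvd_add ?_ ?_)
      · rw [hg', mul_comp, X_pow_comp, hp']
        exact ⟨p' ^ 2 * g'.comp (X * p'), by ring⟩
      · rw [hg]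
        exact ⟨C D * g * u, by ring⟩
      · exact ⟨C (D * (b * c)) * X ^ m, by ring⟩
    have h3 := r1 1 (by omega)
    rw [show f'.comp p * u - ((C (ε₀ (φ v₁)) * X + C D * f) * u + C (D * (b * c)) * X ^ (m + 2)) =
      f'.comp p * u - (C D * f * u + C (D * (b * c)) * X ^ (m + 2)) - C (ε₀ (φ v₁)) * (X * u) by
        ring, coeff_sub, X_pow_dvd_iff.1 h2 1 (by omega), coeff_C_mul, coeff_X_mul] at h3
    simpa [hu0] using h3
  rw [hC0, C_0, zero_mul, zero_add] at r1
  -- the relation `[z, v₀] = 0`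
  have r2 := hφ (ι (0, 1)) v₀
  rw [hw, h.bracket_eq', h'.bracket_eq', h₀, h₁, hA, hB, e] at r2
  simp only [C_0, C_1, zero_mul, mul_zero, one_mul, add_zero] at r2
  rw [← hp, ← Prod.zero_eq_mk, map_zero, map_zero, eq_comm, h.eq_zero_iff] at r2
  replace r2 := r2.1
  have hcop : ∀ k : ℕ, IsCoprime (X ^ k) p' := fun k =>
    (isCoprime_X_of_coeff_zero_ne (by rwa [hp0])).pow_left
  have hwd : X ^ (m + 1) ∣ w := by
    -- p = X p' with p' a unit modulo powers of X, so p w ≡ -B a c X^(n-1) forces X^(n-2) into w.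
    refine (hcop _).dvd_of_dvd_mul_left ?_
    have : X * X ^ (m + 1) ∣ X * (p' * w) := by
      have h3 := dvd_sub ((pow_dvd_pow X (by omega : m + 2 ≤ m + 3)).trans r2)
        (Dvd.intro_left (C (B * (a * c))) rfl : X ^ (m + 2) ∣ C (B * (a * c)) * X ^ (m + 2))
      rw [add_sub_cancel_right, hp'] at h3
      convert h3 using 1 <;> ring
    exact (mul_dvd_mul_iff_left X_ne_zero).1 this
  have hw0 : w.coeff 0 = 0 := X_pow_dvd_iff.1 hwd 0 (by omega)
  have hpow : X ^ (m + 3) ∣ p ^ (m + 2) * u - C (A ^ (m + 2) * u.coeff 0) * X ^ (m + 2) := by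
    convert X_pow_succ_dvd_mul_X_pow_sub (p' ^ (m + 2) * u) (m + 2) using 1
    rw [mul_coeff_zero, coeff_zero_eq_eval_zero (p' ^ (m + 2)), eval_pow,
      ← coeff_zero_eq_eval_zero, hp0, hp']
    ring
  -- If a = 0, then X^(n-1) divides w, so φ(z) and φ(X^(n-1)) are both multiples of X^(n-1), and
  -- their linear dependence contradicts injectivity.
  have ha0 : a ≠ 0 := by
    rintro rfl
    simp only [zero_mul, mul_zero, C_0, add_zero] at r2
    have hw2 : X ^ (m + 2) ∣ w := by
      refine (hcop _).dvd_of_dvd_mul_left ?_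
      have : X * X ^ (m + 2) ∣ X * (p' * w) := by
        rw [hp'] at r2
        convert r2 using 1 <;> ring
      exact (mul_dvd_mul_iff_left X_ne_zero).1 this
    obtain ⟨w', rfl⟩ := hw2
    have h5 : φ (ι ((C (w'.coeff 0) * X ^ (m + 2), - (A ^ (m + 2) * u.coeff 0)))) = 0 := by
      rw [show ((C (w'.coeff 0) * X ^ (m + 2), - (A ^ (m + 2) * u.coeff 0)) : ℂ[X] × ℂ) =
        w'.coeff 0 • (X ^ (m + 2), 0) + (- (A ^ (m + 2) * u.coeff 0)) • (0, 1) by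
          simp [smul_eq_C_mul]]
      rw [map_add, map_smul, map_smul, map_add, map_smul, map_smul, top, hw, ← map_smul,
        ← map_smul, ← map_add]
      simp only [Prod.smul_mk, smul_zero, Prod.mk_add_mk, add_zero]
      rw [h.eq_zero_iff]
      refine ⟨?_, rfl⟩
      have h6 := X_pow_succ_dvd_mul_X_pow_sub w' (m + 2)
      rw [smul_eq_C_mul, smul_eq_C_mul]
      convert dvd_sub (hpow.mul_left (C (w'.coeff 0))) (h6.mul_left (C (A ^ (m + 2) * u.coeff 0)))
        using 1
      rw [C_neg]
      ring
    rw [map_eq_zero_iff _ hinj, h.eq_zero_iff, neg_eq_zero] at h5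
    exact mul_ne_zero (pow_ne_zero _ hA0) hu0 h5.2
  refine ⟨hA0, hu0, ha0, hC0, hw0, ?_, ?_⟩
  · rw [e]
    refine (isCoprime_X_of_coeff_zero_ne hu0).pow_left.dvd_of_dvd_mul_left ?_
    -- Modulo X^n, X^(n-1) equals u X^(n-1) / u(0), so u factors out of the whole congruence.
    have h6 := X_pow_succ_dvd_mul_X_pow_sub u (m + 2)
    convert dvd_sub r1 (h6.mul_left (C (D * b * c / u.coeff 0))) using 1
    have h7 : C (D * (b * c)) = C (D * b * c / u.coeff 0) * C (u.coeff 0) := by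
      rw [← C_mul]
      congr 1
      field_simp
    rw [h7]
    ring
  · -- the relation `[z, v₁] = c' X^(n-1)`
    have r3 := hφ (ι (0, 1)) v₁
    rw [hw, h.bracket_eq', h'.bracket_eq', h₀', h₁', hC0, hD, e] at r3
    simp only [C_0, C_1, zero_mul, mul_zero, zero_add, one_mul] at r3
    rw [show ((C c' * X ^ (m + 2), 0) : ℂ[X] × ℂ) = c' • (X ^ (m + 2), 0) by
      simp [smul_eq_C_mul], map_smul, map_smul, top, ← map_smul, Prod.smul_mk, smul_zero,
      h.eq_iff, smul_eq_C_mul] at r3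
    have hfw : X ^ (m + 3) ∣ C D * f * w := by
      obtain ⟨w', rfl⟩ := hwd
      exact ⟨C D * g * w', by rw [hg]; ring⟩
    have h8 : X ^ (m + 3) ∣
        C (c' * (A ^ (m + 2) * u.coeff 0) - D * (a * c)) * X ^ (m + 2) := by
      convert dvd_sub (dvd_add r3.1 hfw) (hpow.mul_left (C c')) using 1
      simp only [C_sub, C_mul]
      ring
    have h9 := X_pow_dvd_iff.1 h8 (m + 2) (by omega)
    rw [coeff_C_mul, coeff_X_pow_self, mul_one] at h9
    rw [e]
    linear_combination h9

/-- The structure constants that admit an isomorphism. -/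
theorem exists_equiv (hn : 3 ≤ n) [FiniteDimensional ℂ V] (h : L.TruncatedModel n f c ι ε₀ ε₁)
    (h' : L'.TruncatedModel n f' c' ι ε₀ ε₁) {A B D a b u : ℂ} (hA : A ≠ 0) (hu : u ≠ 0)
    (ha : a ≠ 0)
    (hf : X ^ n ∣ f'.comp (C A * X + C B * f) - (C D * f + C (D * b * c / u) * X ^ (n - 1)))
    (hc : c' * (A ^ (n - 1) * u) = D * a * c)
    (hε : ∀ q r s t, q.coeff 0 = u * r.coeff 0 → s = r.coeff 0 * b + t * a →
      ε₀ (ι (q, s)) = A * ε₀ (ι (r, t)) ∧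
        ε₁ (ι (q, s)) = B * ε₀ (ι (r, t)) + D * ε₁ (ι (r, t))) :
    L'.Isomorphic L := by
  obtain ⟨m, rfl⟩ : ∃ m, n = m + 3 := ⟨n - 3, by omega⟩
  have e : m + 3 - 1 = m + 2 := by omega
  rw [e] at hf hc
  obtain ⟨g, hg⟩ := h.X_sq_dvd
  obtain ⟨g', hg'⟩ := h'.X_sq_dvd
  set p := C A * X + C B * f with hp
  obtain ⟨p', hp', hp0⟩ : ∃ p', p = X * p' ∧ p'.coeff 0 = A :=
    ⟨C A + C B * (X * g), by rw [hp, hg]; ring, by simp⟩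
  have hp1 : p.coeff 0 = 0 := by rw [hp']; simp
  have hcomp0 (q : ℂ[X]) : (q.comp p).coeff 0 = q.coeff 0 := by
    rw [coeff_zero_eq_eval_zero, eval_comp, ← coeff_zero_eq_eval_zero, hp1,
      coeff_zero_eq_eval_zero]
  -- The solution of p w + B a c X^(n-1) ≡ 0 mod X^n; only the linear term A X of p acts on X^(n-2).
  set w : ℂ[X] := C (-(B * a * c / A)) * X ^ (m + 1) with hw
  -- The term in `y.1.coeff 1` is the error that bz adds to the image of X. A constant u is enough,
  -- since the relations see only u(0).
  let Ψ : ℂ[X] × ℂ →ₗ[ℂ] ℂ[X] × ℂ :=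
    { toFun := fun y => (C u * y.1.comp p + C (y.1.coeff 1 * (b * B * c)) * X ^ (m + 2) + C y.2 * w,
        y.1.coeff 0 * b + y.2 * a)
      map_add' := by
        rintro ⟨q, s⟩ ⟨r, t⟩
        ext1
        · simp only [Prod.mk_add_mk, add_comp, coeff_add, add_mul, C_add]
          ring
        · simp only [Prod.mk_add_mk, coeff_add]
          ring
      map_smul' := by
        rintro k ⟨q, s⟩
        ext1
        · simp only [Prod.smul_mk, smul_eq_C_mul, mul_comp, C_comp, coeff_C_mul, C_mul,
            RingHom.id_apply, smul_eq_mul k s]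
          ring
        · simp only [Prod.smul_mk, coeff_smul, smul_eq_mul, RingHom.id_apply]
          ring }
  have hΨ (q : ℂ[X]) (s : ℂ) : Ψ (q, s) =
      (C u * q.comp p + C (q.coeff 1 * (b * B * c)) * X ^ (m + 2) + C s * w,
        q.coeff 0 * b + s * a) := rfl
  have hΨ0 (y : ℂ[X] × ℂ) (hy : ι y = 0) : ι (Ψ y) = 0 := by
    obtain ⟨q, s⟩ := y
    obtain ⟨⟨r, rfl⟩, rfl⟩ := (h.eq_zero_iff _ _).1 hy
    have c0 : (X ^ (m + 3) * r).coeff 0 = 0 := X_pow_dvd_iff.1 ⟨r, rfl⟩ 0 (by omega)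
    have c1 : (X ^ (m + 3) * r).coeff 1 = 0 := X_pow_dvd_iff.1 ⟨r, rfl⟩ 1 (by omega)
    rw [hΨ, c0, c1, h.eq_zero_iff, mul_comp, X_pow_comp, hp']
    refine ⟨⟨C u * p' ^ (m + 3) * r.comp (X * p'), ?_⟩, by simp⟩
    simp only [zero_mul, C_0, add_zero]
    ring
  -- Ψ descends along ι: it preserves the kernel, so the choice of section is immaterial.
  obtain ⟨σ, hσ⟩ := ι.exists_rightInverse_of_surjective (LinearMap.range_eq_top.2 h.surjective)
  let φ : V →ₗ[ℂ] V := ι ∘ₗ Ψ ∘ₗ σ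
  have hφ (y : ℂ[X] × ℂ) : φ (ι y) = ι (Ψ y) := by
    change ι (Ψ (σ (ι y))) = _
    rw [← sub_eq_zero, ← map_sub, ← map_sub]
    apply hΨ0
    rw [map_sub, ← LinearMap.comp_apply, hσ, LinearMap.id_apply, sub_self]
  have hinj : Function.Injective φ := by
    rw [injective_iff_map_eq_zero]
    intro v hv
    obtain ⟨⟨q, s⟩, rfl⟩ := h.surjective v
    rw [hφ, hΨ, h.eq_zero_iff] at hv
    obtain ⟨hd, hs⟩ := hv
    -- Clearing the constant coefficient, then s, then the coefficient of X removes both correction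
    -- terms and leaves u q(p).
    have q0 : q.coeff 0 = 0 := by
      have := X_pow_dvd_iff.1 hd 0 (by omega)
      rw [coeff_add, coeff_add, coeff_C_mul, hcomp0] at this
      simpa [hw, coeff_X_pow, hu] using this
    rw [q0, zero_mul, zero_add] at hs
    obtain rfl : s = 0 := by simpa [ha] using hs
    obtain ⟨q, rfl⟩ := X_dvd_iff.2 q0
    have q1 : (X * q).coeff 1 = 0 := by
      have := X_pow_dvd_iff.1 hd 1 (by omega)
      rw [mul_comp, X_comp, hp'] at this
      rw [show C u * (X * p' * q.comp (X * p')) = X * (C u * p' * q.comp (X * p')) by ring,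
        ← hp', C_0, zero_mul, add_zero, coeff_add, coeff_X_mul, mul_coeff_zero, hcomp0, mul_coeff_zero, hp0] at this
      rw [coeff_C_mul, coeff_X_pow, if_neg (by omega), mul_zero, add_zero, coeff_C_zero] at this
      rw [coeff_X_mul]
      exact (mul_eq_zero.1 this).resolve_left (mul_ne_zero hu hA)
    rw [q1, zero_mul, C_0, zero_mul, zero_mul, add_zero, add_zero] at hd
    rw [h.eq_zero_iff]
    refine ⟨?_, rfl⟩
    have hd' : X ^ (m + 3) ∣ (X * q).comp p := by
      refine (isCoprime_X_of_coeff_zero_ne (u := C u) (by simpa)).pow_left.dvd_of_dvd_mul_left hd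
    -- Substituting p, which is X times a unit modulo powers of X, does not raise the order of
    -- vanishing.
    have : ∀ k (r : ℂ[X]), X ^ k ∣ r.comp p → X ^ k ∣ r := by
      intro k
      induction k with
      | zero => simp
      | succ k ih =>
        intro r hr
        have : r.coeff 0 = 0 := by
          rw [← hcomp0]
          exact X_pow_dvd_iff.1 hr 0 (by omega)
        obtain ⟨r, rfl⟩ := X_dvd_iff.2 this
        rw [mul_comp, X_comp, hp', pow_succ', mul_assoc, mul_dvd_mul_iff_left X_ne_zero] at hr
        rw [pow_succ']
        refine mul_dvd_mul_left _ (ih r ?_)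
        rw [hp']
        exact (isCoprime_X_of_coeff_zero_ne (by rwa [hp0])).pow_left.dvd_of_dvd_mul_left hr
    exact this _ _ hd'
  refine ⟨LinearEquiv.ofInjectiveEndo φ hinj, fun x y => ?_⟩
  rw [LinearEquiv.coe_ofInjectiveEndo]
  obtain ⟨⟨q, s⟩, rfl⟩ := h.surjective x
  obtain ⟨⟨r, t⟩, rfl⟩ := h.surjective y
  have hε' := hε (C u * r.comp p + C (r.coeff 1 * (b * B * c)) * X ^ (m + 2) + C t * w) r
    (r.coeff 0 * b + t * a) t (by
      rw [coeff_add, coeff_add, coeff_C_mul, hcomp0]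
      simp [hw, coeff_X_pow]) rfl
  rw [hφ (r, t), hφ (q, s), hΨ, hΨ, h.bracket_eq', h'.bracket_eq', hε'.1, hε'.2, hφ, hΨ, e,
    h.eq_iff]
  set x₀ := ε₀ (ι (r, t))
  set x₁ := ε₁ (ι (r, t))
  have c0 : ((C x₀ * X + C x₁ * f') * q + C (x₁ * (s * c')) * X ^ (m + 2)).coeff 0 = 0 := by
    simp [hg']
  have c1 : ((C x₀ * X + C x₁ * f') * q + C (x₁ * (s * c')) * X ^ (m + 2)).coeff 1 =
      x₀ * q.coeff 0 := by
    rw [hg', show (C x₀ * X + C x₁ * (X ^ 2 * g')) * q + C (x₁ * (s * c')) * X ^ (m + 2) =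
      X * (C x₀ * q + X * (C x₁ * g' * q + C (x₁ * (s * c')) * X ^ m)) by ring, coeff_X_mul]
    simp
  rw [c0, c1]
  refine ⟨?_, by simp⟩
  obtain ⟨d1, hd1⟩ := hf
  obtain ⟨d2, hd2⟩ := X_pow_succ_dvd_mul_X_pow_sub (q.comp p) (m + 2)
  rw [hcomp0] at hd2
  obtain ⟨d3, hd3⟩ : X ^ (m + 3) ∣ p ^ (m + 2) - C (A ^ (m + 2)) * X ^ (m + 2) := by
    have := X_pow_succ_dvd_mul_X_pow_sub (p' ^ (m + 2)) (m + 2)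
    rw [coeff_zero_eq_eval_zero, eval_pow, ← coeff_zero_eq_eval_zero, hp0] at this
    convert this using 1
    rw [hp']
    ring
  -- Against w, a multiple of X^(n-2), only the linear part x₀ A X survives; by `hW` it cancels x₀ B
  -- s a c X^(n-1).
  obtain ⟨g2, hg2⟩ : ∃ g2, C (x₀) * p + C (x₁ * D) * f = X * C (x₀ * A) + X ^ 2 * g2 :=
    ⟨C x₀ * C B * g + C (x₁ * D) * g, by rw [hp, hg]; simp only [C_mul]; ring⟩
  have hK : C u * C (D * b * c / u) = C D * C b * C c := by
    simp only [← C_mul]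
    congr 1
    field_simp
  have hW : C A * C (-(B * a * c / A)) = - (C B * C a * C c) := by
    simp only [← C_mul, ← C_neg]
    congr 1
    field_simp
  have hc' : C c' * (C (A ^ (m + 2)) * C u) = C D * C a * C c := by
    simp only [← C_mul, hc]
  rw [sub_eq_iff_eq_add] at hd1 hd2 hd3
  refine ⟨C u * C x₁ * d1 * q.comp p + C x₁ * (C D * C b * C c) * d2 + C u * C x₁ * C s * C c' * d3 -
    (C x₀ * C A + X * g2) * C (q.coeff 1 * (b * B * c)) - C s * g2 * C (-(B * a * c / A)), ?_⟩
  have hq : C (A * x₀) * X + C (B * x₀ + D * x₁) * f = C x₀ * p + C (x₁ * D) * f := by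
    rw [hp]
    simp only [C_mul, C_add]
    ring
  rw [hq, add_comp, mul_comp, add_comp, mul_comp, mul_comp, mul_comp, C_comp, C_comp, C_comp,
    X_pow_comp, X_comp, hd1, hd3, hw]
  simp only [C_mul, C_add, C_0] at hg2 hd2 hK ⊢
  linear_combination C x₁ * (C D * C b * C c) * hd2 + C x₁ * q.comp p * X ^ (m + 2) * hK +
    C x₁ * C s * X ^ (m + 2) * hc' - C s * C x₀ * X ^ (m + 2) * hW -
    (C (q.coeff 1) * (C b * C B * C c) * X ^ (m + 2) +
      C s * C (-(B * a * c / A)) * X ^ (m + 1)) * hg2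

end LeibnizAlgebra.TruncatedModel

end TruncatedPolynomialModel
-- Structure polynomials and the coefficients Φ.
noncomputable section

namespace FiliformLeibniz

open Polynomial

/-- The polynomial `∑ α_k X^(k-1)`, `3 ≤ k ≤ n`, by which `e_1` multiplies from the right. -/
def structurePoly (n : ℕ) (α : ℕ → ℂ) : ℂ[X] := ∑ k ∈ Icc 3 n, C (α k) * X ^ (k - 1)

/-- The quotient of `structurePoly n α` by `X^2`. -/
def reducedPoly (n : ℕ) (α : ℕ → ℂ) : ℂ[X] := ∑ k ∈ Icc 3 n, C (α k) * X ^ (k - 3)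

theorem structurePoly_eq (n : ℕ) (α : ℕ → ℂ) : structurePoly n α = X ^ 2 * reducedPoly n α := by
  rw [structurePoly, reducedPoly, mul_sum]
  refine sum_congr rfl fun k hk => ?_
  rw [mem_Icc] at hk
  rw [show k - 1 = 2 + (k - 3) by omega, pow_add]
  ring

theorem coeff_structurePoly {n : ℕ} (α : ℕ → ℂ) {t : ℕ} (h3 : 3 ≤ t) (ht : t ≤ n) :
    (structurePoly n α).coeff (t - 1) = α t := by
  rw [structurePoly, finsetSum_coeff, sum_eq_single t]
  · simp
  · intro k hk hkt
    rw [mem_Icc] at hk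
    rw [coeff_C_mul_X_pow, if_neg (by omega)]
  · intro h
    exact absurd (mem_Icc.2 ⟨h3, ht⟩) h

theorem coeff_reducedPoly {n : ℕ} (α : ℕ → ℂ) {d : ℕ} (hd : d + 3 ≤ n) :
    (reducedPoly n α).coeff d = α (d + 3) := by
  rw [← coeff_structurePoly α (by omega) hd, structurePoly_eq, show d + 3 - 1 = d + 2 by omega,
    coeff_X_pow_mul]

/-- Each summation sign is one Cauchy product, η_{t+3-i} being the coefficient of degree t - i. The
bound on t keeps all indices at most n, where `reducedPoly` is cut off. -/
theorem coeff_reducedPoly_pow {n : ℕ} (α : ℕ → ℂ) (s r t : ℕ) (hst : s ≤ t) (ht : t + 3 - s ≤ n) :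
    (reducedPoly n α ^ (r + 1)).coeff (t - s) = nestedSum α s r t := by
  induction r generalizing t with
  | zero =>
    rw [zero_add, pow_one, coeff_reducedPoly α (by omega), nestedSum]
    congr 1
    omega
  | succ r ih =>
    rw [pow_succ, coeff_mul, Nat.sum_antidiagonal_eq_sum_range_succ_mk, nestedSum,
      ← Finset.Ico_add_one_right_eq_Icc, sum_Ico_eq_sum_range]
    refine sum_congr (by congr 1; simp; omega) fun i hi => ?_
    rw [mem_range] at hi
    rw [coeff_reducedPoly α (by omega), ← ih (s + i) (by omega) (by omega), mul_comm]
    congr 2 <;> omega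

variable {n : ℕ} (α : ℕ → ℂ) (A B : ℂ)

theorem exists_X_mul : ∃ p' : ℂ[X], C A * X + C B * structurePoly n α = X * p' ∧
    p'.coeff 0 = A :=
  ⟨C A + C B * (X * reducedPoly n α), by rw [structurePoly_eq]; ring, by simp⟩

theorem coeff_pow_of_lt {k t : ℕ} (hk : t < k) (ht : 1 ≤ t) :
    ((C A * X + C B * structurePoly n α) ^ (k - 1)).coeff (t - 1) = 0 := by
  obtain ⟨p', hp', -⟩ := exists_X_mul (n := n) α A B
  rw [hp', mul_pow, coeff_X_pow_mul', if_neg (by omega)]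

theorem coeff_pow_self (t : ℕ) :
    ((C A * X + C B * structurePoly n α) ^ (t - 1)).coeff (t - 1) = A ^ (t - 1) := by
  obtain ⟨p', hp', h0⟩ := exists_X_mul (n := n) α A B
  rw [hp', mul_pow, coeff_X_pow_mul', if_pos le_rfl, Nat.sub_self, coeff_zero_eq_eval_zero,
    eval_pow, ← coeff_zero_eq_eval_zero, h0]

theorem coeff_pow_of_gt {k t : ℕ} (hk : 3 ≤ k) (hkt : k < t) (ht : t ≤ n) :
    ((C A * X + C B * structurePoly n α) ^ (k - 1)).coeff (t - 1) = coeff α A B k t := by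
  rw [add_comm, add_pow, finsetSum_coeff, show k - 1 + 1 = k by omega, range_eq_Ico,
    sum_eq_sum_Ico_succ_bot (by omega)]
  -- The term m = 0 lives in degree k - 1 < t - 1, which is why Φ starts at m = 1.
  have h0 : ((C B * structurePoly n α) ^ 0 * (C A * X) ^ (k - 1 - 0) *
      ((k - 1).choose 0 : ℂ[X])).coeff (t - 1) = 0 := by
    rw [pow_zero, one_mul, mul_pow, ← C_pow, Nat.choose_zero_right, Nat.cast_one, mul_one,
      coeff_C_mul_X_pow, if_neg (by omega)]
  rw [h0, zero_add, coeff]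
  refine sum_congr (by ext; simp; omega) fun m hm => ?_
  rw [mem_Icc] at hm
  have e1 : (C B * structurePoly n α) ^ m * (C A * X) ^ (k - 1 - m) * ((k - 1).choose m : ℂ[X]) =
      C (((k - 1).choose (k - 1 - m) : ℂ) * A ^ (k - 1 - m) * B ^ m) *
        (X ^ (k - 1 + m) * reducedPoly n α ^ m) := by
    rw [structurePoly_eq, Nat.choose_symm hm.2, show k - 1 + m = (k - 1 - m) + 2 * m by omega,
      pow_add, pow_mul, C_mul, C_mul, C_pow, C_pow, ← C_eq_natCast]
    ring
  rw [e1, coeff_C_mul, coeff_X_pow_mul']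
  congr 1
  obtain ⟨r, rfl⟩ : ∃ r, m = r + 1 := ⟨m - 1, by omega⟩
  rw [Nat.add_sub_cancel]
  split_ifs with h
  · rw [← coeff_reducedPoly_pow (n := n) α _ _ _ (by omega) (by omega)]
    congr 1
    omega
  -- Here k + m > t. As k < t, this excludes m = 1, whose nested sum has no summation sign; the
  -- others are empty.
  · obtain ⟨r, rfl⟩ : ∃ r', r = r' + 1 := ⟨r - 1, by omega⟩
    rw [nestedSum, Icc_eq_empty (by omega), sum_empty]

/-- As X divides p, the coefficients of the powers of p form a triangular array with diagonal
A^(t-1), so the sum stops at t. -/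
theorem coeff_comp (α' : ℕ → ℂ) {t : ℕ} (h3 : 3 ≤ t) (ht : t ≤ n) :
    ((structurePoly n α').comp (C A * X + C B * structurePoly n α)).coeff (t - 1) =
      A ^ (t - 1) * α' t + ∑ k ∈ Icc 3 (t - 1), coeff α A B k t * α' k := by
  have h (k : ℕ) : ((C (α' k) * X ^ (k - 1)).comp (C A * X + C B * structurePoly n α)).coeff
      (t - 1) = α' k * ((C A * X + C B * structurePoly n α) ^ (k - 1)).coeff (t - 1) := by
    rw [mul_comp, C_comp, X_pow_comp, coeff_C_mul]
  conv_lhs => rw [structurePoly]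
  rw [Polynomial.sum_comp, finsetSum_coeff]
  simp only [h]
  rw [← sum_subset (Icc_subset_Icc_right ht : Icc 3 t ⊆ Icc 3 n)]
  · obtain ⟨s, rfl⟩ : ∃ s, t = s + 1 := ⟨t - 1, by omega⟩
    rw [sum_Icc_succ_top h3, coeff_pow_self, Nat.add_sub_cancel, add_comm, mul_comm]
    congr 1
    refine sum_congr rfl fun k hk => ?_
    rw [mem_Icc] at hk
    have := coeff_pow_of_gt (n := n) α A B hk.1 (by omega : k < s + 1) ht
    rw [Nat.add_sub_cancel] at this
    rw [this, mul_comm]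
  · intro k hk hk'
    rw [mem_Icc] at hk hk'
    rw [coeff_pow_of_lt α A B (by omega) (by omega), mul_zero]

/-- Everything is divisible by X^2, so only degrees t - 1 with 3 ≤ t ≤ n carry a condition. -/
theorem X_pow_dvd_comp_sub_iff (hn : 3 ≤ n) (α' : ℕ → ℂ) (D K : ℂ) :
    X ^ n ∣ (structurePoly n α').comp (C A * X + C B * structurePoly n α) -
        (C D * structurePoly n α + C K * X ^ (n - 1)) ↔
      ∀ t, 3 ≤ t → t ≤ n → A ^ (t - 1) * α' t + ∑ k ∈ Icc 3 (t - 1), coeff α A B k t * α' k =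
        D * α t + if t = n then K else 0 := by
  have key (t : ℕ) (h3 : 3 ≤ t) (ht : t ≤ n) :
      ((structurePoly n α').comp (C A * X + C B * structurePoly n α) -
        (C D * structurePoly n α + C K * X ^ (n - 1))).coeff (t - 1) = 0 ↔
      A ^ (t - 1) * α' t + ∑ k ∈ Icc 3 (t - 1), coeff α A B k t * α' k =
        D * α t + if t = n then K else 0 := by
    rw [coeff_sub, sub_eq_zero, coeff_comp α A B α' h3 ht, coeff_add, coeff_C_mul,
      coeff_structurePoly α h3 ht, coeff_C_mul_X_pow]
    simp only [show t - 1 = n - 1 ↔ t = n by omega]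
  rw [X_pow_dvd_iff]
  constructor
  · intro h t h3 ht
    exact (key t h3 ht).1 (h _ (by omega))
  · intro h d hd
    rcases Nat.lt_or_ge d 2 with h2 | h2
    · have h0 : X ^ 2 ∣ (structurePoly n α').comp (C A * X + C B * structurePoly n α) -
          (C D * structurePoly n α + C K * X ^ (n - 1)) := by
        refine dvd_sub ?_ (dvd_add ?_ ?_)
        · obtain ⟨p', hp', -⟩ := exists_X_mul (n := n) α A B
          rw [structurePoly_eq n α', mul_comp, X_pow_comp, hp', mul_pow, mul_assoc]
          exact dvd_mul_right _ _
        · rw [structurePoly_eq]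
          exact (dvd_mul_right _ _).mul_left _
        · exact (pow_dvd_pow X (by omega)).mul_left _
      exact X_pow_dvd_iff.1 h0 d h2
    · exact (key (d + 1) (by omega) (by omega)).2 (h (d + 1) (by omega) (by omega))

end FiliformLeibniz
end

theorem LeibnizAlgebra.Isomorphic.symm {K V W : Type*} [Field K] [AddCommGroup V] [Module K V]
    [AddCommGroup W] [Module K W] {L : LeibnizAlgebra K V} {M : LeibnizAlgebra K W}
    (h : L.Isomorphic M) : M.Isomorphic L := by
  obtain ⟨φ, hφ⟩ := h
  exact ⟨φ.symm, fun x y => by rw [LinearEquiv.symm_apply_eq, hφ]; simp⟩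

/-! ### Coordinates: both families as truncated models. -/

noncomputable section

namespace FiliformLeibniz

section Coordinates

open Polynomial

/-- The coordinates of `q(x) o + s z` on `ℂ^(n+1)`, where `x^k o = e_{k+1}` for `k ≥ 1`,
`o = κ₀ e_0 + κ₁ e_1` and `z = l₀ e_0 + l₁ e_1`. -/
def ofPoly (n : ℕ) (κ₀ κ₁ l₀ l₁ : ℂ) : ℂ[X] × ℂ →ₗ[ℂ] Fin (n + 1) → ℂ where
  toFun y i := if (i : ℕ) = 0 then κ₀ * y.1.coeff 0 + l₀ * y.2
    else if (i : ℕ) = 1 then κ₁ * y.1.coeff 0 + l₁ * y.2 else y.1.coeff (i - 1)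
  map_add' x y := by
    ext i
    simp only [Prod.fst_add, Prod.snd_add, coeff_add, Pi.add_apply]
    split_ifs <;> ring
  map_smul' a y := by
    ext i
    simp only [Prod.smul_fst, Prod.smul_snd, coeff_smul, smul_eq_mul, Pi.smul_apply,
      RingHom.id_apply]
    split_ifs <;> ring

variable {n : ℕ} {κ₀ κ₁ l₀ l₁ : ℂ}

theorem ofPoly_apply (q : ℂ[X]) (s : ℂ) (i : Fin (n + 1)) :
    ofPoly n κ₀ κ₁ l₀ l₁ (q, s) i = if (i : ℕ) = 0 then κ₀ * q.coeff 0 + l₀ * s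
      else if (i : ℕ) = 1 then κ₁ * q.coeff 0 + l₁ * s else q.coeff (i - 1) := rfl

theorem ofPoly_apply_zero (q : ℂ[X]) (s : ℂ) :
    ofPoly n κ₀ κ₁ l₀ l₁ (q, s) ⟨0, by omega⟩ = κ₀ * q.coeff 0 + l₀ * s := rfl

theorem ofPoly_apply_one (hn : 3 ≤ n) (q : ℂ[X]) (s : ℂ) :
    ofPoly n κ₀ κ₁ l₀ l₁ (q, s) ⟨1, by omega⟩ = κ₁ * q.coeff 0 + l₁ * s := rfl

theorem e_apply (i : ℕ) (j : Fin (n + 1)) : e n i j = if (j : ℕ) = i then 1 else 0 := by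
  split_ifs with h
  · rw [e, dif_pos (h ▸ j.2)]
    subst h
    exact Pi.single_eq_same _ _
  · exact e_apply_of_ne j (Ne.symm h)

theorem ofPoly_surjective (hn : 3 ≤ n) (hdet : κ₀ * l₁ - κ₁ * l₀ ≠ 0) :
    Function.Surjective (ofPoly n κ₀ κ₁ l₀ l₁) := by
  intro v
  set x₀ := v ⟨0, by omega⟩ with hx₀
  set x₁ := v ⟨1, by omega⟩ with hx₁
  set d := κ₀ * l₁ - κ₁ * l₀ with hd
  have hc (k : ℕ) : (∑ j : Fin (n + 1), if 2 ≤ (j : ℕ) then C (v j) * X ^ ((j : ℕ) - 1) else 0 :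
      ℂ[X]).coeff k = if h : 1 ≤ k ∧ k < n then v ⟨k + 1, by omega⟩ else 0 := by
    rw [finsetSum_coeff]
    split_ifs with h
    · rw [sum_eq_single ⟨k + 1, by omega⟩]
      · rw [if_pos (by simp; omega), coeff_C_mul_X_pow, if_pos (by simp)]
      · intro j _ hj
        have hj' : (j : ℕ) ≠ k + 1 := fun h' => hj (Fin.ext h')
        split_ifs with h2
        · rw [coeff_C_mul_X_pow, if_neg (by omega)]
        · simp
      · simp
    · refine sum_eq_zero fun j _ => ?_
      split_ifs with h2
      · have := j.2
        rw [coeff_C_mul_X_pow, if_neg (by omega)]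
      · simp
  -- Cramer's rule in the plane of e_0 and e_1; the other coordinates are read off as coefficients.
  refine ⟨(C ((l₁ * x₀ - l₀ * x₁) / d) +
    ∑ j : Fin (n + 1), if 2 ≤ (j : ℕ) then C (v j) * X ^ ((j : ℕ) - 1) else 0,
    (κ₀ * x₁ - κ₁ * x₀) / d), ?_⟩
  ext i
  rw [ofPoly_apply]
  simp only [coeff_add, hc]
  rw [dif_neg (by omega : ¬ (1 ≤ 0 ∧ 0 < n)), coeff_C_zero, add_zero]
  split_ifs with h0 h1 h2
  · rw [show v i = x₀ by rw [hx₀]; congr 1; exact Fin.ext h0]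
    field_simp
    rw [hd]
    ring
  · rw [show v i = x₁ by rw [hx₁]; congr 1; exact Fin.ext h1]
    field_simp
    rw [hd]
    ring
  · rw [coeff_C, if_neg (by omega), zero_add]
    congr 1
    exact Fin.ext (by simp; omega)
  · have := i.2
    omega

theorem ofPoly_eq_zero_iff (hn : 3 ≤ n) (hdet : κ₀ * l₁ - κ₁ * l₀ ≠ 0) (q : ℂ[X]) (s : ℂ) :
    ofPoly n κ₀ κ₁ l₀ l₁ (q, s) = 0 ↔ X ^ n ∣ q ∧ s = 0 := by
  rw [X_pow_dvd_iff]
  constructor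
  · intro h
    have h0 := congr_fun h ⟨0, by omega⟩
    have h1 := congr_fun h ⟨1, by omega⟩
    rw [ofPoly_apply_zero, Pi.zero_apply] at h0
    rw [ofPoly_apply_one hn, Pi.zero_apply] at h1
    refine ⟨fun d hd => ?_, ?_⟩
    · rcases Nat.eq_zero_or_pos d with rfl | hd0
      · refine (mul_eq_zero.1 ?_).resolve_left hdet
        linear_combination l₁ * h0 - l₀ * h1
      · have h2 := congr_fun h ⟨d + 1, by omega⟩
        rw [ofPoly_apply, if_neg (by simp), if_neg (by simp; omega)] at h2
        exact h2
    · refine (mul_eq_zero.1 ?_).resolve_left hdet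
      linear_combination κ₀ * h1 - κ₁ * h0
  · rintro ⟨h, rfl⟩
    ext i
    have := i.2
    rw [ofPoly_apply, h 0 (by omega), h (i - 1) (by omega)]
    simp

/-- No upper bound on k is needed: for k ≥ n both sides are 0, by the default value of `e`. -/
theorem ofPoly_X_pow {k : ℕ} (hk : 1 ≤ k) : ofPoly n κ₀ κ₁ l₀ l₁ (X ^ k, 0) = e n (k + 1) := by
  ext i
  rw [ofPoly_apply, e_apply, coeff_X_pow, coeff_X_pow, if_neg (by omega : ¬ 0 = k)]
  split_ifs <;> first | omega | simp

theorem ofPoly_structurePoly_mul (α : ℕ → ℂ) (q : ℂ[X]) :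
    ofPoly n κ₀ κ₁ l₀ l₁ (structurePoly n α * q, 0) =
      ∑ k ∈ Icc 3 n, α k • ofPoly n κ₀ κ₁ l₀ l₁ (X ^ (k - 1) * q, 0) := by
  rw [structurePoly, sum_mul]
  simp only [← map_smul]
  rw [← map_sum]
  refine congrArg _ ?_
  ext1
  · rw [Prod.fst_sum]
    change ∑ k ∈ Icc 3 n, C (α k) * X ^ (k - 1) * q = _
    refine sum_congr rfl fun k _ => ?_
    rw [Prod.smul_fst, smul_eq_C_mul, mul_assoc]
  · simp [Prod.snd_sum]

/-- In the bracket of a table without products `[e_i, e_j]`, `j ≥ 2`, only the coordinates of the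
right factor at `e_0` and `e_1` matter. -/
theorem bracketOfTable_eq (hn : 3 ≤ n) {T : ℕ → ℕ → Fin (n + 1) → ℂ}
    (h0 : ∀ i j, 2 ≤ j → T i j = 0) (x y : Fin (n + 1) → ℂ) :
    bracketOfTable n T x y = y ⟨0, by omega⟩ • bracketOfTable n T x (e n 0) +
      y ⟨1, by omega⟩ • bracketOfTable n T x (e n 1) := by
  have hbas (k : Fin (n + 1)) : Pi.basisFun ℂ (Fin (n + 1)) k = e n k := by
    rw [e, dif_pos k.2, Pi.basisFun_apply]
  have key : bracketOfTable n T x = (LinearMap.proj (R := ℂ) (φ := fun _ : Fin (n + 1) => ℂ)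
      ⟨0, by omega⟩).smulRight (bracketOfTable n T x (e n 0)) +
      (LinearMap.proj (R := ℂ) (φ := fun _ : Fin (n + 1) => ℂ)
      ⟨1, by omega⟩).smulRight (bracketOfTable n T x (e n 1)) := by
    refine (Pi.basisFun ℂ (Fin (n + 1))).ext fun j => ?_
    rw [hbas]
    simp only [LinearMap.add_apply, LinearMap.smulRight_apply, LinearMap.proj_apply, e_apply]
    rcases Nat.lt_or_ge j 2 with hj | hj
    · obtain hj | hj : (j : ℕ) = 0 ∨ (j : ℕ) = 1 := by omega
      · simp [hj]
      · simp [hj]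
    · rw [if_neg (by omega), if_neg (by omega), zero_smul, zero_smul, add_zero]
      have : (bracketOfTable n T).flip (e n j) = 0 := by
        refine (Pi.basisFun ℂ (Fin (n + 1))).ext fun i => ?_
        rw [hbas, LinearMap.flip_apply, bracketOfTable_e T (by omega) (by omega), h0 _ _ hj,
          LinearMap.zero_apply]
      exact LinearMap.congr_fun this x
  exact LinearMap.congr_fun key y

theorem truncatedModel_of_table (hn : 3 ≤ n) (hdet : κ₀ * l₁ - κ₁ * l₀ ≠ 0)
    (L : LeibnizAlgebra ℂ (Fin (n + 1) → ℂ)) {T : ℕ → ℕ → Fin (n + 1) → ℂ}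
    (hL : L.bracket = bracketOfTable n T) (h0 : ∀ i j, 2 ≤ j → T i j = 0) (α : ℕ → ℂ) (c : ℂ)
    (hX : ∀ k : ℕ, bracketOfTable n T (ofPoly n κ₀ κ₁ l₀ l₁ (X ^ k, 0)) (e n 0) = e n (k + 2))
    (hz : bracketOfTable n T (ofPoly n κ₀ κ₁ l₀ l₁ (0, 1)) (e n 0) = 0)
    (hf : ∀ k : ℕ, bracketOfTable n T (ofPoly n κ₀ κ₁ l₀ l₁ (X ^ k, 0)) (e n 1) =
      ∑ j ∈ Icc 3 n, α j • e n (j + k))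
    (hz' : bracketOfTable n T (ofPoly n κ₀ κ₁ l₀ l₁ (0, 1)) (e n 1) = c • e n n) :
    L.TruncatedModel n (structurePoly n α) c (ofPoly n κ₀ κ₁ l₀ l₁)
      (LinearMap.proj ⟨0, by omega⟩) (LinearMap.proj ⟨1, by omega⟩) where
  surjective := ofPoly_surjective hn hdet
  eq_zero_iff := ofPoly_eq_zero_iff hn hdet
  X_sq_dvd := ⟨_, structurePoly_eq n α⟩
  bracket_eq q s v := by
    rw [hL, bracketOfTable_eq hn h0, LinearMap.proj_apply, LinearMap.proj_apply]
    have split (q : ℂ[X]) (s : ℂ) : ((q, s) : ℂ[X] × ℂ) = (q, 0) + s • (0, 1) := by simp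
    have E0 : (bracketOfTable n T).flip (e n 0) ∘ₗ ofPoly n κ₀ κ₁ l₀ l₁ ∘ₗ LinearMap.inl ℂ ℂ[X] ℂ =
        ofPoly n κ₀ κ₁ l₀ l₁ ∘ₗ LinearMap.inl ℂ ℂ[X] ℂ ∘ₗ LinearMap.mulLeft ℂ X := by
      refine lhom_ext' fun k => LinearMap.ext_ring ?_
      simp only [LinearMap.comp_apply, LinearMap.flip_apply, LinearMap.inl_apply,
        LinearMap.mulLeft_apply, monomial_one_right_eq_X_pow]
      rw [hX, ← pow_succ', ofPoly_X_pow (by omega)]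
    have E1 : (bracketOfTable n T).flip (e n 1) ∘ₗ ofPoly n κ₀ κ₁ l₀ l₁ ∘ₗ LinearMap.inl ℂ ℂ[X] ℂ =
        ofPoly n κ₀ κ₁ l₀ l₁ ∘ₗ LinearMap.inl ℂ ℂ[X] ℂ ∘ₗ
          LinearMap.mulLeft ℂ (structurePoly n α) := by
      refine lhom_ext' fun k => LinearMap.ext_ring ?_
      simp only [LinearMap.comp_apply, LinearMap.flip_apply, LinearMap.inl_apply,
        LinearMap.mulLeft_apply, monomial_one_right_eq_X_pow]
      rw [hf, ofPoly_structurePoly_mul]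
      refine sum_congr rfl fun j hj => ?_
      rw [mem_Icc] at hj
      rw [← pow_add, ofPoly_X_pow (by omega)]
      congr 2
      omega
    have E0' := LinearMap.congr_fun E0 q
    have E1' := LinearMap.congr_fun E1 q
    simp only [LinearMap.comp_apply, LinearMap.flip_apply, LinearMap.inl_apply,
      LinearMap.mulLeft_apply] at E0' E1'
    have E2 : ofPoly n κ₀ κ₁ l₀ l₁ (structurePoly n α * q + C (s * c) * X ^ (n - 1), 0) =
        ofPoly n κ₀ κ₁ l₀ l₁ (structurePoly n α * q, 0) + s • c • e n n := by
      obtain ⟨m, rfl⟩ : ∃ m, n = m + 2 := ⟨n - 2, by omega⟩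
      rw [show m + 2 - 1 = m + 1 by omega,
        ← ofPoly_X_pow (n := m + 2) (κ₀ := κ₀) (κ₁ := κ₁) (l₀ := l₀) (l₁ := l₁)
          (by omega : 1 ≤ m + 1), ← map_smul, ← map_smul, ← map_add]
      congr 1
      simp [smul_eq_C_mul, mul_assoc]
    rw [split q s, map_add, map_smul, map_add, map_smul, LinearMap.add_apply, LinearMap.add_apply,
      LinearMap.smul_apply, LinearMap.smul_apply, E0', E1', hz, hz', smul_zero, add_zero, E2]

theorem sum_smul_e (α : ℕ → ℂ) (i : ℕ) :
    ∑ k ∈ Icc 3 (n + 1 - (i + 1)), α k • e n (i + 1 + k - 1) = ∑ j ∈ Icc 3 n, α j • e n (j + i) := by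
  rw [← sum_subset (Icc_subset_Icc_right (by omega) : Icc 3 (n + 1 - (i + 1)) ⊆ Icc 3 n)]
  · refine sum_congr rfl fun k _ => ?_
    congr 2
    omega
  · intro k hk hk'
    rw [mem_Icc] at hk hk'
    rw [e_of_gt (by omega), smul_zero]

theorem truncatedModel_mu₁ (hn : 3 ≤ n) (α : ℕ → ℂ) (θ : ℂ) :
    (mu₁ n hn α θ).TruncatedModel n (structurePoly n α) (θ - α n) (ofPoly n 0 1 1 (-1))
      (LinearMap.proj ⟨0, by omega⟩) (LinearMap.proj ⟨1, by omega⟩) := by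
  have hX (k : ℕ) : ofPoly n 0 1 1 (-1) (X ^ k, 0) = e n (k + 1) := by
    rcases Nat.eq_zero_or_pos k with rfl | hk
    · ext i
      rw [ofPoly_apply, e_apply, pow_zero, coeff_one, coeff_one]
      split_ifs <;> first | omega | simp
    · exact ofPoly_X_pow hk
  have hz : ofPoly n 0 1 1 (-1) (0, 1) = e n 0 - e n 1 := by
    ext i
    rw [ofPoly_apply, Pi.sub_apply, e_apply, e_apply]
    split_ifs <;> first | omega | simp
  refine truncatedModel_of_table hn (by simp) _ (T := table₁ n α θ) rfl ?_ α (θ - α n) ?_ ?_ ?_ ?_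
  · intro i j hj
    unfold table₁
    rw [if_neg (by omega), if_neg (by omega), if_neg (by omega), if_neg (by omega)]
  · intro k
    rw [hX]
    rcases Nat.lt_or_ge n (k + 1) with h | h
    · rw [e_of_gt h, e_of_gt (show n < k + 2 by omega), map_zero, LinearMap.zero_apply]
    · rw [bracketOfTable_e _ h (by omega), table₁_zero _ _ (by omega)]
  · rw [hz, map_sub, LinearMap.sub_apply, bracketOfTable_e _ (by omega) (by omega),
      bracketOfTable_e _ (by omega) (by omega), table₁_zero _ _ le_rfl, sub_eq_zero]
    simp [table₁]
  · intro k
    rw [hX]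
    rcases Nat.lt_or_ge n (k + 1) with h | h
    · rw [e_of_gt h, map_zero, LinearMap.zero_apply, sum_eq_zero]
      intro j hj
      rw [mem_Icc] at hj
      rw [e_of_gt (by omega), smul_zero]
    · rw [bracketOfTable_e _ h (by omega), table₁_one _ _ (by omega), sum_smul_e]
  · rw [hz, map_sub, LinearMap.sub_apply, bracketOfTable_e _ (by omega) (by omega),
      bracketOfTable_e _ (by omega) (by omega), table₁_one _ _ le_rfl]
    have e1 : table₁ n α θ 0 1 = (∑ k ∈ Icc 3 (n - 1), α k • e n k) + θ • e n n := by
      simp [table₁]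
    have e2 := sum_smul_e (n := n) α 0
    rw [zero_add] at e2
    rw [e1, e2]
    obtain ⟨m, rfl⟩ : ∃ m, n = m + 1 := ⟨n - 1, by omega⟩
    rw [Nat.add_sub_cancel, sum_Icc_succ_top hn]
    simp only [add_zero]
    module

theorem truncatedModel_mu₂ (hn : 3 ≤ n) (β : ℕ → ℂ) (γ : ℂ) :
    (mu₂ n hn β γ).TruncatedModel n (structurePoly n β) γ (ofPoly n 1 0 0 1)
      (LinearMap.proj ⟨0, by omega⟩) (LinearMap.proj ⟨1, by omega⟩) := by
  have h1 : ofPoly n 1 0 0 1 (1, 0) = e n 0 := by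
    ext i
    rw [ofPoly_apply, e_apply, coeff_one, coeff_one]
    split_ifs <;> first | omega | simp
  have hz : ofPoly n 1 0 0 1 (0, 1) = e n 1 := by
    ext i
    rw [ofPoly_apply, e_apply]
    split_ifs <;> first | omega | simp
  refine truncatedModel_of_table hn (by simp) _ (T := table₂ n β γ) rfl ?_ β γ ?_ ?_ ?_ ?_
  · intro i j hj
    unfold table₂
    rw [if_neg (by omega), if_neg (by omega), if_neg (by omega), if_neg (by omega),
      if_neg (by omega)]
  · intro k
    rcases Nat.eq_zero_or_pos k with rfl | hk
    · rw [pow_zero, h1, bracketOfTable_e _ (by omega) (by omega)]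
      simp [table₂]
    · rw [ofPoly_X_pow hk]
      rcases Nat.lt_or_ge n (k + 1) with h | h
      · rw [e_of_gt h, e_of_gt (show n < k + 2 by omega), map_zero, LinearMap.zero_apply]
      · rw [bracketOfTable_e _ h (by omega), table₂_zero _ _ (by omega)]
  · rw [hz, bracketOfTable_e _ (by omega) (by omega)]
    simp [table₂]
  · intro k
    rcases Nat.eq_zero_or_pos k with rfl | hk
    · rw [pow_zero, h1, bracketOfTable_e _ (by omega) (by omega)]
      simp [table₂]
    · rw [ofPoly_X_pow hk]
      rcases Nat.lt_or_ge n (k + 1) with h | h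
      · rw [e_of_gt h, map_zero, LinearMap.zero_apply, sum_eq_zero]
        intro j hj
        rw [mem_Icc] at hj
        rw [e_of_gt (by omega), smul_zero]
      · rw [bracketOfTable_e _ h (by omega), table₂_one _ _ (by omega), sum_smul_e]
  · rw [hz, bracketOfTable_e _ (by omega) (by omega)]
    simp [table₂]

/-! ### Isomorphism criteria for the two families. -/

theorem ofPoly_eq_smul_add : ofPoly n κ₀ κ₁ l₀ l₁ (1, 0) = κ₀ • e n 0 + κ₁ • e n 1 ∧
    ofPoly n κ₀ κ₁ l₀ l₁ (0, 1) = l₀ • e n 0 + l₁ • e n 1 := by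
  constructor <;>
  · ext i
    rw [ofPoly_apply, Pi.add_apply, Pi.smul_apply, Pi.smul_apply, e_apply, e_apply]
    split_ifs <;> first | omega | (rw [coeff_one, if_neg (by omega)]; simp) | simp

/-- Isomorphism in the first family, in terms of structure polynomials. -/
theorem isomorphic_mu₁_iff (hn : 3 ≤ n) (α α' : ℕ → ℂ) (θ θ' : ℂ) :
    (mu₁ n hn α θ).Isomorphic (mu₁ n hn α' θ') ↔ ∃ A B : ℂ, A * (A + B) ≠ 0 ∧
      X ^ n ∣ (structurePoly n α').comp (C A * X + C B * structurePoly n α) -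
        (C (A + B) * structurePoly n α + C 0 * X ^ (n - 1)) ∧
      (θ' - α' n) * A ^ (n - 1) = A * (θ - α n) := by
  have h := truncatedModel_mu₁ hn α θ
  have h' := truncatedModel_mu₁ hn α' θ'
  constructor
  · intro hiso
    -- The substitution f'(p) arises from a map out of the primed algebra.
    obtain ⟨φ, hφ⟩ := hiso.symm
    obtain ⟨⟨u, b⟩, hu⟩ := h.surjective (φ (ofPoly n 0 1 1 (-1) (1, 0)))
    obtain ⟨⟨w, a⟩, hw⟩ := h.surjective (φ (ofPoly n 0 1 1 (-1) (0, 1)))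
    obtain ⟨hA, hu0, -, hC, hw0, hf, hc⟩ := h.of_hom hn h' φ.toLinearMap φ.injective hφ
      (v₀ := e n 0) (v₁ := e n 1) (by simp [e_apply]) (by simp [e_apply]) (by simp [e_apply])
      (by simp [e_apply]) rfl rfl rfl hu.symm hw.symm
    rw [ofPoly_eq_smul_add.1] at hu
    rw [ofPoly_eq_smul_add.2] at hw
    have u0 := congr_fun hu ⟨0, by omega⟩
    have u1 := congr_fun hu ⟨1, by omega⟩
    have w0 := congr_fun hw ⟨0, by omega⟩
    have w1 := congr_fun hw ⟨1, by omega⟩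
    rw [ofPoly_apply_zero] at u0 w0
    rw [ofPoly_apply_one hn] at u1 w1
    simp only [map_add, map_smul, Pi.add_apply, Pi.smul_apply, smul_eq_mul] at u0 u1 w0 w1
    simp only [LinearMap.proj_apply, LinearEquiv.coe_coe] at hA hC hf hc
    rw [hC] at u0 w0
    set A := φ (e n 0) ⟨0, by omega⟩
    set B := φ (e n 0) ⟨1, by omega⟩
    set D := φ (e n 1) ⟨1, by omega⟩
    -- Here o = e_1 and z = e_0 - e_1, and `hC` says that φ(e_1) has no e_0-coordinate.
    have hb : b = 0 := by linear_combination u0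
    have ha : a = A := by linear_combination w0
    have hD : D = A + B := by
      linear_combination w1 - hw0 + ha
    have huD : u.coeff 0 = A + B := by linear_combination u1 + hb + hD
    rw [hb, hD, mul_zero, zero_mul, zero_div] at hf
    rw [huD] at hu0
    refine ⟨A, B, mul_ne_zero hA hu0, hf, mul_right_cancel₀ hu0 ?_⟩
    rw [huD, hD, ha] at hc
    linear_combination hc
  · rintro ⟨A, B, hAB, hf, hc⟩
    obtain ⟨hA, hD⟩ := mul_ne_zero_iff.1 hAB
    refine (h.exists_equiv hn h' (A := A) (B := B) (D := A + B) (a := A) (b := 0) (u := A + B)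
      hA hD hA ?_ ?_ ?_).symm
    · rwa [mul_zero, zero_mul, zero_div]
    · linear_combination (A + B) * hc
    · intro q r s t hq hs
      simp only [LinearMap.proj_apply]
      rw [ofPoly_apply_zero, ofPoly_apply_zero, ofPoly_apply_one hn, ofPoly_apply_one hn, hq, hs]
      constructor <;> ring

/-- Isomorphism in the second family, in terms of structure polynomials. -/
theorem isomorphic_mu₂_iff (hn : 3 ≤ n) (β β' : ℕ → ℂ) (γ γ' : ℂ) :
    (mu₂ n hn β γ).Isomorphic (mu₂ n hn β' γ') ↔ ∃ A B D : ℂ, A * D ≠ 0 ∧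
      X ^ n ∣ (structurePoly n β').comp (C A * X + C B * structurePoly n β) -
        (C D * structurePoly n β + C (D * B * γ / A) * X ^ (n - 1)) ∧
      γ' * A ^ n = D ^ 2 * γ := by
  have h := truncatedModel_mu₂ hn β γ
  have h' := truncatedModel_mu₂ hn β' γ'
  obtain ⟨m, hm⟩ : ∃ m, n = m + 1 := ⟨n - 1, by omega⟩
  have hpow (A : ℂ) : A ^ n = A ^ (n - 1) * A := by rw [hm, Nat.add_sub_cancel, pow_succ]
  constructor
  · intro hiso
    obtain ⟨φ, hφ⟩ := hiso.symm
    obtain ⟨⟨u, b⟩, hu⟩ := h.surjective (φ (ofPoly n 1 0 0 1 (1, 0)))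
    obtain ⟨⟨w, a⟩, hw⟩ := h.surjective (φ (ofPoly n 1 0 0 1 (0, 1)))
    obtain ⟨hA, hu0, ha0, hC, hw0, hf, hc⟩ := h.of_hom hn h' φ.toLinearMap φ.injective hφ
      (v₀ := e n 0) (v₁ := e n 1) (by simp [e_apply]) (by simp [e_apply]) (by simp [e_apply])
      (by simp [e_apply]) rfl rfl rfl hu.symm hw.symm
    rw [ofPoly_eq_smul_add.1] at hu
    rw [ofPoly_eq_smul_add.2] at hw
    have u0 := congr_fun hu ⟨0, by omega⟩
    have u1 := congr_fun hu ⟨1, by omega⟩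
    have w1 := congr_fun hw ⟨1, by omega⟩
    rw [ofPoly_apply_zero] at u0
    rw [ofPoly_apply_one hn] at u1 w1
    simp only [map_add, map_smul, Pi.add_apply, Pi.smul_apply, smul_eq_mul] at u0 u1 w1
    simp only [LinearMap.proj_apply, LinearEquiv.coe_coe] at hA hC hf hc
    set A := φ (e n 0) ⟨0, by omega⟩
    set B := φ (e n 0) ⟨1, by omega⟩
    set D := φ (e n 1) ⟨1, by omega⟩
    -- Here o = e_0 and z = e_1, so the coordinates of φ(e_0) and φ(e_1) are read off directly.
    have hb : b = B := by linear_combination u1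
    have ha : a = D := by linear_combination w1
    have huA : u.coeff 0 = A := by linear_combination u0
    rw [hb, huA] at hf
    rw [ha] at ha0
    refine ⟨A, B, D, mul_ne_zero hA ha0, hf, ?_⟩
    rw [huA, ha] at hc
    rw [hpow]
    linear_combination hc
  · rintro ⟨A, B, D, hAD, hf, hc⟩
    obtain ⟨hA, hD⟩ := mul_ne_zero_iff.1 hAD
    refine (h.exists_equiv hn h' (A := A) (B := B) (D := D) (a := D) (b := B) (u := A)
      hA hA hD hf ?_ ?_).symm
    · rw [hpow] at hc
      linear_combination hc
    · intro q r s t hq hs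
      simp only [LinearMap.proj_apply]
      rw [ofPoly_apply_zero, ofPoly_apply_zero, ofPoly_apply_one hn, ofPoly_apply_one hn, hq, hs]
      constructor <;> ring

end Coordinates

/-! ### From coefficient equations to the explicit recursions. -/

theorem eq_one_div_mul_sub_iff {a x y s : ℂ} (ha : a ≠ 0) :
    x = 1 / a * (y - s) ↔ a * x + s = y := by
  rw [one_div, eq_inv_mul_iff_mul_eq₀ ha, eq_sub_iff_add_eq]

theorem eq_div_mul_iff_of_coeff_three {A D x y : ℂ} (hA : A ≠ 0) :
    x = D / A ^ 2 * y ↔ A ^ (3 - 1) * x = D * y := by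
  rw [div_mul_eq_mul_div, eq_div_iff (pow_ne_zero 2 hA), mul_comm]

end FiliformLeibniz

end

open FiliformLeibniz in
theorem theorem4p4 (n : ℕ) (hn : 3 ≤ n) :
    (∀ (α α' : ℕ → ℂ) (θ θ' : ℂ),
      (mu₁ n hn α θ).Isomorphic (mu₁ n hn α' θ') ↔
        ∃ A B : ℂ, A * (A + B) ≠ 0 ∧
          α' 3 = (A + B) / A ^ 2 * α 3 ∧
          (∀ t : ℕ, 4 ≤ t → t ≤ n →
            α' t = 1 / A ^ (t - 1) *
              ((A + B) * α t - ∑ k ∈ Finset.Icc 3 (t - 1), coeff α A B k t * α' k)) ∧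
          θ' = 1 / A ^ (n - 1) *
            (A * θ + B * α n - ∑ k ∈ Finset.Icc 3 (n - 1), coeff α A B k n * α' k)) ∧
    (∀ (β β' : ℕ → ℂ) (γ γ' : ℂ),
      (mu₂ n hn β γ).Isomorphic (mu₂ n hn β' γ') ↔
        ∃ A B D : ℂ, A * D ≠ 0 ∧
          γ' = D ^ 2 / A ^ n * γ ∧
          (4 ≤ n → β' 3 = D / A ^ 2 * β 3) ∧
          (∀ t : ℕ, 4 ≤ t → t ≤ n - 1 →
            β' t = 1 / A ^ (t - 1) *
              (D * β t - ∑ k ∈ Finset.Icc 3 (t - 1), coeff β A B k t * β' k)) ∧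
          β' n = B * D * γ / A ^ n + 1 / A ^ (n - 1) *
            (D * β n - ∑ k ∈ Finset.Icc 3 (n - 1), coeff β A B k n * β' k)) := by
  have hsum (η η' : ℕ → ℂ) (A B : ℂ) :
      ∑ k ∈ Icc 3 (3 - 1), coeff η A B k 3 * η' k = 0 := by
    rw [Icc_eq_empty (by omega), sum_empty]
  constructor
  · intro α α' θ θ'
    rw [isomorphic_mu₁_iff]
    refine exists_congr fun A => exists_congr fun B => and_congr_right fun hAB => ?_
    have hA : A ≠ 0 := left_ne_zero_of_mul hAB
    rw [X_pow_dvd_comp_sub_iff _ _ _ hn]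
    simp only [eq_one_div_mul_sub_iff (pow_ne_zero _ hA), eq_div_mul_iff_of_coeff_three hA,
      ite_self, add_zero]
    constructor
    · rintro ⟨h, hθ⟩
      refine ⟨by simpa only [hsum, add_zero] using h 3 le_rfl hn,
        fun t h4 ht => h t (by omega) ht, ?_⟩
      -- Adding the equation for t = n to the one for θ' - α'_n eliminates α'_n.
      linear_combination h n hn le_rfl + hθ
    · rintro ⟨h3, h4, hθ⟩
      have h : ∀ t, 3 ≤ t → t ≤ n → A ^ (t - 1) * α' t +
          ∑ k ∈ Icc 3 (t - 1), coeff α A B k t * α' k = (A + B) * α t := by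
        intro t ht htn
        rcases ht.eq_or_lt with rfl | ht
        · rw [hsum, add_zero, h3]
        · exact h4 t ht htn
      refine ⟨h, ?_⟩
      linear_combination hθ - h n hn le_rfl
  · intro β β' γ γ'
    rw [isomorphic_mu₂_iff]
    refine exists_congr fun A => exists_congr fun B => exists_congr fun D =>
      and_congr_right fun hAD => ?_
    have hA : A ≠ 0 := left_ne_zero_of_mul hAD
    have hγ : γ' = D ^ 2 / A ^ n * γ ↔ γ' * A ^ n = D ^ 2 * γ := by
      rw [div_mul_eq_mul_div, eq_div_iff (pow_ne_zero n hA)]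
    have hlast (s : ℂ) : β' n = B * D * γ / A ^ n + 1 / A ^ (n - 1) * (D * β n - s) ↔
        A ^ (n - 1) * β' n + s = D * β n + D * B * γ / A := by
      obtain ⟨m, hm⟩ : ∃ m, n = m + 1 := ⟨n - 1, by omega⟩
      have : B * D * γ / A ^ n + 1 / A ^ (n - 1) * (D * β n - s) =
          1 / A ^ (n - 1) * (D * β n + D * B * γ / A - s) := by
        rw [show A ^ n = A ^ (n - 1) * A by rw [hm, Nat.add_sub_cancel, pow_succ]]
        field_simp
        ring
      rw [this, eq_one_div_mul_sub_iff (pow_ne_zero _ hA)]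
    rw [X_pow_dvd_comp_sub_iff _ _ _ hn, hγ, hlast, and_comm]
    refine and_congr_right fun _ => ?_
    simp only [eq_one_div_mul_sub_iff (pow_ne_zero _ hA), eq_div_mul_iff_of_coeff_three hA]
    constructor
    · intro h
      refine ⟨fun h4 => ?_, fun t h4 ht => ?_, ?_⟩
      · have := h 3 le_rfl hn
        rwa [hsum, if_neg (by omega), add_zero, add_zero] at this
      · have := h t (by omega) (by omega)
        rwa [if_neg (by omega), add_zero] at this
      · simpa using h n hn le_rfl
    · rintro ⟨h3, h4, hl⟩ t ht htn
      -- The perturbation occurs only at t = n. For n = 3 this is also the first equation, so the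
      -- formula for β'_3 is needed only when n ≥ 4.
      rcases htn.eq_or_lt with rfl | htn
      · rw [if_pos rfl, hl]
      · rw [if_neg (by omega), add_zero]
        rcases ht.eq_or_lt with rfl | ht
        · rw [hsum, add_zero, h3 (by omega)]
        · exact h4 t ht (by omega)
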